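/- **Proposition 3.1.** Conventions. A point process on $\mathbb R$ is a random countable subset $X\subset\mathbb R$ whose numbers of points in Borel sets are random variables. Its $n$-th correlation function $\rho_n\ge 0$ (relative to Lebesgue measure, defined up to null sets) is determined by the condition that, for all Borel sets $A_1,\dots,A_n$, the expected number of ordered $n$-tuples of pairwise distinct points of $X$ lying in $A_1\times\dots\times A_n$ equals $\int_{A_1\times\dots\times A_n}\rho_n\,dx_1\cdots dx_n$. Let $X$ be a point process on $(0,+\infty)$ whose first correlation function $\rho_1$ is integrable on $(\varepsilon,+\infty)$ and not integrable on $(0,\varepsilon)$, for every $\varepsilon>0$. For $\tau\ge0$ let $\widehat X_\tau$ be the image of $X\cap(0,1]$ under the map $x\mapsto\int_x^1\rho_1(y)\,dy-\tau$. A point process $Y$ on $\mathbb R$ is called a tail process for $X$ if, for every $n$, the $n$-th correlation function of $\widehat X_\tau$ tends to the $n$-th correlation function of $Y$ as $\tau\to+\infty$, uniformly on compact subsets of $\mathbb R^n$ (for suitable versions of these functions). For $t>0$ the Poisson–Dirichlet process $PD(t)$ is the point process on $(0,1]$ formed by the points $v_k=u_k\prod_{i<k}(1-u_i)$, $k=0,1,2,\dots$,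 where $u_0,u_1,\dots$ are independent with density $t(1-u)^{t-1}$ on $(0,1)$ (the Poisson–Dirichlet distribution is the law of the decreasing rearrangement of $(v_k)$). Statement. Let $t>0$ and let $X$ be a Poisson–Dirichlet process $PD(t)$. Then: 1. The tail process for $X$ is the Poisson process on $\mathbb R$ with constant density $1$: a point process $Y$ on $\mathbb R$ is a tail process for $X$ if and only if it is a Poisson process whose intensity measure is Lebesgue measure. 2. In the variables $\xi=-t\log x$ the correlation functions of $X$ tend to those of this Poisson process: for every $n$, the image of $X$ under $x\mapsto -t\log x$ has an $n$-th correlation function $\rho'_n(\xi_1,\dots,\xi_n)$, of which a suitable version tends to $1$ as $\min\{\xi_1,\dots,\xi_n\}\to+\infty$. -/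

import Mathlib

open MeasureTheory ProbabilityTheory Filter Topology
open scoped ENNReal

noncomputable section

/-- A (simple) point process on `ℝ`: a random countable subset `X` of `ℝ`, defined on a probability
space `(Ω, P)`, such that the number of points in every Borel set is a random variable with values
in `{0, 1, 2, …, ∞}`. -/
structure IsPointProcess {Ω : Type*} [MeasurableSpace Ω] (X : Ω → Set ℝ) (P : Measure Ω) :
    Prop where
  countable : ∀ᵐ ω ∂P, (X ω).Countable
  aemeasurable_count : ∀ A : Set ℝ, MeasurableSet A →
    AEMeasurable (fun ω => (X ω ∩ A).encard) P

/-- Two random subsets of `ℝ` are equal in law as point processes: the numbers of points in any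
finite family of Borel sets have the same joint distribution. -/
def SamePointProcessLaw {Ω Ω' : Type*} [MeasurableSpace Ω] [MeasurableSpace Ω']
    (X : Ω → Set ℝ) (P : Measure Ω) (X' : Ω' → Set ℝ) (P' : Measure Ω') : Prop :=
  ∀ (m : ℕ) (A : Fin m → Set ℝ), (∀ i, MeasurableSet (A i)) →
    IdentDistrib (fun ω i => (X ω ∩ A i).encard) (fun ω i => (X' ω ∩ A i).encard) P P'

/-- `ρ` is (a version of) the `n`-th correlation function of `X` with respect to Lebesgue measure:
for all Borel sets `A₁, …, Aₙ`, the expected number of ordered `n`-tuples of pairwise distinct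
points of `X` lying in `A₁ × ⋯ × Aₙ` is the integral of `ρ` over `A₁ × ⋯ × Aₙ`. -/
structure IsCorrelationFunction {Ω : Type*} [MeasurableSpace Ω] (X : Ω → Set ℝ) (P : Measure Ω)
    (n : ℕ) (ρ : (Fin n → ℝ) → ℝ) : Prop where
  measurable : Measurable ρ
  nonneg : ∀ x, 0 ≤ ρ x
  lintegral_count : ∀ A : Fin n → Set ℝ, (∀ i, MeasurableSet (A i)) →
    ∫⁻ ω, (({x : Fin n → ℝ | Function.Injective x ∧ ∀ i, x i ∈ X ω ∩ A i}.encard : ℕ∞) : ℝ≥0∞) ∂P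
      = ∫⁻ x in Set.univ.pi A, ENNReal.ofReal (ρ x)

/-- Convergence of the processes `Z τ` to `Y` as `τ → +∞`: for every `n`, the `n`-th correlation
function of `Z τ` tends to the `n`-th correlation function of `Y` uniformly on compact sets
(correlation functions are determined up to null sets; the convergence is that of suitable
versions). -/
def TendstoInCorrelation {Ω Ω' : Type*} [MeasurableSpace Ω] [MeasurableSpace Ω']
    (Z : ℝ → Ω → Set ℝ) (P : Measure Ω) (Y : Ω' → Set ℝ) (P' : Measure Ω') : Prop :=
  ∀ n : ℕ, ∃ (r : ℝ → (Fin n → ℝ) → ℝ) (s : (Fin n → ℝ) → ℝ),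
    (∀ τ : ℝ, 0 ≤ τ → IsCorrelationFunction (Z τ) P n (r τ)) ∧
    IsCorrelationFunction Y P' n s ∧
    ∀ K : Set (Fin n → ℝ), IsCompact K → TendstoUniformlyOn r s atTop K

/-- The change of variable `x ↦ ∫_x^1 ρ₁(y) dy` which makes the density of a process on `(0, 1]`
with first correlation function `ρ₁` constant. -/
def tailMap (ρ₁ : ℝ → ℝ) (x : ℝ) : ℝ := ∫ y in x..1, ρ₁ y

/-- `Y` is a tail process for the point process `X` on `(0, +∞)`. The first correlation function
`ρ₁` of `X` is integrable on the right of every `ε > 0` and not integrable near `0`, and the images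
of `X ∩ (0, 1]` under `x ↦ ∫_x^1 ρ₁(y) dy - τ` converge to the point process `Y` as `τ → +∞`. -/
structure IsTailProcess {Ω Ω' : Type*} [MeasurableSpace Ω] [MeasurableSpace Ω']
    (X : Ω → Set ℝ) (P : Measure Ω) (Y : Ω' → Set ℝ) (P' : Measure Ω') : Prop where
  isPointProcess : IsPointProcess X P
  pos : ∀ᵐ ω ∂P, X ω ⊆ Set.Ioi 0
  isPointProcess_limit : IsPointProcess Y P'
  exists_density : ∃ ρ₁ : ℝ → ℝ,
    IsCorrelationFunction X P 1 (fun x => ρ₁ (x 0)) ∧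
    (∀ ε : ℝ, 0 < ε → IntegrableOn ρ₁ (Set.Ioi ε)) ∧
    (∀ ε : ℝ, 0 < ε → ¬ IntegrableOn ρ₁ (Set.Ioo 0 ε)) ∧
    TendstoInCorrelation
      (fun τ ω => (fun x => tailMap ρ₁ x - τ) '' (X ω ∩ Set.Ioc 0 1)) P Y P'

/-- `Y` is a Poisson process on `ℝ` with intensity measure `ν`: the numbers of points in pairwise
disjoint Borel sets of finite `ν`-measure are independent, and the number of points in a Borel set
`A` with `ν A < ∞` has the Poisson distribution with mean `ν A`. -/
structure IsPoissonProcess {Ω : Type*} [MeasurableSpace Ω] (Y : Ω → Set ℝ) (P : Measure Ω)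
    (ν : Measure ℝ) : Prop where
  isPointProcess : IsPointProcess Y P
  indep : ∀ (m : ℕ) (A : Fin m → Set ℝ), (∀ i, MeasurableSet (A i)) → (∀ i, ν (A i) ≠ ∞) →
    Pairwise (fun i j => Disjoint (A i) (A j)) →
    iIndepFun (fun i ω => (Y ω ∩ A i).encard) P
  law : ∀ A : Set ℝ, MeasurableSet A → ν A ≠ ∞ →
    HasLaw (fun ω => (Y ω ∩ A).encard)
      ((poissonMeasure (ν A).toNNReal).map (Nat.cast : ℕ → ℕ∞)) P

/-- The stick-breaking sequence `vₖ = uₖ (1 - u₀) ⋯ (1 - uₖ₋₁)`. -/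
def stickBreaking (u : ℕ → ℝ) (k : ℕ) : ℝ := u k * ∏ i ∈ Finset.range k, (1 - u i)

/-- The law of a sequence of independent random variables with the distribution `Beta(1, t)`,
whose density is `t (1 - u) ^ (t - 1)` on `(0, 1)`. -/
def iidBeta (t : ℝ) : Measure (ℕ → ℝ) := Measure.infinitePi (fun _ => betaMeasure 1 t)

/-- `X` is a Poisson–Dirichlet process `PD(t)`. The Poisson–Dirichlet distribution with parameter
`t` is the law of the decreasing rearrangement of the stick-breaking sequence built from independent
`Beta(1, t)` variables; the corresponding point process consists of the points of that sequence
(as a configuration of points it does not depend on their ordering). -/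
structure IsPoissonDirichletProcess {Ω : Type*} [MeasurableSpace Ω] (t : ℝ) (X : Ω → Set ℝ)
    (P : Measure Ω) : Prop where
  isPointProcess : IsPointProcess X P
  sameLaw : SamePointProcessLaw X P (fun u : ℕ → ℝ => Set.range (stickBreaking u)) (iidBeta t)

end

/-! The correlation functions of $PD(t)$ are explicit: on the simplex $x_i>0$, $S=\sum x_i<1$, they
equal $t^n(1-S)^{t-1}/\prod x_i$ (`pdCorrelation`). Everything else follows from this formula and
from the fact that Poisson processes of density 1 are exactly the point processes whose correlation
functions are all 1.

The formula comes from self-similarity. After the first stick $u$ is removed, the remaining sticks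
are $1-u$ times an independent copy of the whole sequence. A point tuple either avoids the first
stick or uses it exactly once, which gives a recursion for expectations of products of linear
statistics with disjoint supports (`stickMoment_succ`). Integrals against the candidate density
satisfy the same recursion (`pdIntegral_succ`); there it reduces to the identity $1=(1-S)+\sum x_i$.
For test functions bounded by $cx$ both quantities are $O(c^n)$, and each use of the recursion
multiplies the possible discrepancy by $E(1-u)^n=t/(t+n)<1$, so they agree
(`stickMoment_eq_pdIntegral`). Products of disjoint sets suffice to identify a correlation function,
because distinct points are eventually separated by dyadic intervals
(`IsCorrelationFunction.of_disjoint`).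

In the tail variable, whose derivative is $-\rho_1$, the correlation function becomes
$(1-S)^{t-1}\prod(1-x_i)^{1-t}$; in the variable $-t\log x$ it is $(1-S)^{t-1}$. Both tend to 1 as
all $x_i\to0$, which is where a compact set is sent by a large shift $\tau$, and also where all
$\xi_i$ are large.

Conversely, correlation functions are unique up to null sets under local finiteness
(`IsCorrelationFunction.ae_eq`), so those of any tail process are 1 almost everywhere. They give the
joint factorial moments of counts in disjoint sets, and absolutely convergent inclusion–exclusion
recovers from these the independent Poisson laws (`isPoissonProcess_of_isCorrelationFunction_one`).
-/

/-! ### Separating distinct points by dyadic intervals -/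

/-- The index of the dyadic interval of length `2 ^ (-m)` that contains `x`. -/
noncomputable def dyadicCell (m : ℕ) (x : ℝ) : ℤ := ⌊x * 2 ^ m⌋

lemma measurable_dyadicCell (m : ℕ) : Measurable (dyadicCell m) := by
  unfold dyadicCell; fun_prop

lemma dyadicCell_eq_of_succ {m : ℕ} {x y : ℝ} (h : dyadicCell (m + 1) x = dyadicCell (m + 1) y) :
    dyadicCell m x = dyadicCell m y := by
  have key : ∀ z : ℝ, dyadicCell m z = dyadicCell (m + 1) z / 2 := by
    intro z
    have h1 := Int.floor_div_natCast (z * 2 ^ (m + 1)) 2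
    have h2 : z * 2 ^ (m + 1) / ((2 : ℕ) : ℝ) = z * 2 ^ m := by
      push_cast; rw [pow_succ]; ring
    rw [h2] at h1
    exact h1
  rw [key x, key y, h]

lemma dyadicCell_ne_of_le {m m' : ℕ} (hm : m ≤ m') {x y : ℝ}
    (h : dyadicCell m x ≠ dyadicCell m y) : dyadicCell m' x ≠ dyadicCell m' y := by
  induction m', hm using Nat.le_induction with
  | base => exact h
  | succ k _ ih => exact fun h' => ih (dyadicCell_eq_of_succ h')

lemma exists_dyadicCell_ne {x y : ℝ} (h : x ≠ y) : ∃ m, dyadicCell m x ≠ dyadicCell m y := by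
  obtain ⟨m, hm⟩ := pow_unbounded_of_one_lt (1 / |x - y|) (one_lt_two)
  refine ⟨m, fun heq => ?_⟩
  have hpos : 0 < |x - y| := abs_pos.mpr (sub_ne_zero.mpr h)
  have h1 := Int.abs_sub_lt_one_of_floor_eq_floor heq
  rw [← sub_mul, abs_mul, abs_of_pos (by positivity : (0 : ℝ) < 2 ^ m)] at h1
  rw [div_lt_iff₀ hpos] at hm
  linarith

/-- Configurations of `n` points of `A` lying in pairwise distinct dyadic intervals. -/
def separatedTuples {n : ℕ} (A : Fin n → Set ℝ) (m : ℕ) : Set (Fin n → ℝ) :=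
  {x | (∀ i, x i ∈ A i) ∧ Function.Injective (dyadicCell m ∘ x)}

lemma monotone_separatedTuples {n : ℕ} {A : ℕ → Fin n → Set ℝ} (hA : Monotone A) :
    Monotone fun m => separatedTuples (A m) m := by
  rintro m m' hm x ⟨hx, hinj⟩
  refine ⟨fun i => hA hm i (hx i), fun i j hij => ?_⟩
  by_contra hne
  exact dyadicCell_ne_of_le hm (fun h => hne (hinj h)) hij

/-- There are finitely many coordinates and pairs of coordinates, so one level $m$ serves for all
memberships and all separations at once. -/
lemma iUnion_separatedTuples {n : ℕ} {A : ℕ → Fin n → Set ℝ} (hA : Monotone A) :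
    ⋃ m, separatedTuples (A m) m = {x | Function.Injective x ∧ ∀ i, x i ∈ ⋃ m, A m i} := by
  ext x
  simp only [Set.mem_iUnion, Set.mem_ofPred_eq]
  constructor
  · rintro ⟨m, hx, hinj⟩
    exact ⟨fun i j hij => hinj (by simp [hij]), fun i => ⟨m, hx i⟩⟩
  · rintro ⟨hinj, hx⟩
    choose M hM using hx
    have : ∀ p : Fin n × Fin n, ∃ m, p.1 ≠ p.2 → dyadicCell m (x p.1) ≠ dyadicCell m (x p.2) := by
      rintro ⟨i, j⟩
      by_cases hij : i = j
      · exact ⟨0, fun h => absurd hij h⟩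
      · obtain ⟨m, hm⟩ := exists_dyadicCell_ne (fun h => hij (hinj h))
        exact ⟨m, fun _ => hm⟩
    choose m hm using this
    refine ⟨Finset.univ.sup M ⊔ Finset.univ.sup m, fun i => ?_, fun i j hij => ?_⟩
    · exact hA ((Finset.le_sup (Finset.mem_univ i)).trans le_sup_left) i (hM i)
    · by_contra hne
      exact dyadicCell_ne_of_le ((Finset.le_sup (Finset.mem_univ (i, j))).trans le_sup_right)
        (hm (i, j) hne) hij

lemma separatedTuples_eq_iUnion {n : ℕ} (A : Fin n → Set ℝ) (m : ℕ) :
    separatedTuples A m = ⋃ J : {J : Fin n → ℤ // Function.Injective J},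
      Set.univ.pi fun i => A i ∩ dyadicCell m ⁻¹' {J.1 i} := by
  ext x
  simp only [separatedTuples, Set.mem_ofPred_eq, Set.mem_iUnion, Set.mem_univ_pi, Set.mem_inter_iff,
    Set.mem_preimage, Set.mem_singleton_iff]
  constructor
  · rintro ⟨hx, hinj⟩
    exact ⟨⟨dyadicCell m ∘ x, hinj⟩, fun i => ⟨hx i, rfl⟩⟩
  · rintro ⟨J, hJ⟩
    refine ⟨fun i => (hJ i).1, ?_⟩
    have : dyadicCell m ∘ x = J.1 := funext fun i => (hJ i).2
    rw [this]; exact J.2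

lemma pairwise_disjoint_dyadic_pi {n : ℕ} (A : Fin n → Set ℝ) (m : ℕ) :
    Pairwise (Function.onFun Disjoint fun J : {J : Fin n → ℤ // Function.Injective J} =>
      Set.univ.pi fun i => A i ∩ dyadicCell m ⁻¹' {J.1 i}) := by
  intro J J' hne
  refine Set.disjoint_left.mpr fun x hx hx' => hne (Subtype.ext (funext fun i => ?_))
  exact (hx i trivial).2.symm.trans (hx' i trivial).2

lemma encard_univ_pi {n : ℕ} (S : Fin n → Set ℝ) :
    (Set.univ.pi S).encard = ∏ i, (S i).encard := by
  have key : ∀ (n : ℕ) (T : Fin n → Set ℝ), ENat.card (∀ i, T i) = ∏ i, ENat.card (T i) := by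
    intro n
    induction n with
    | zero => intro T; simp
    | succ n ih =>
      intro T
      rw [← ENat.card_congr (Fin.consEquiv fun i => T i), ENat.card_prod, Fin.prod_univ_succ,
        ih fun i => T i.succ]
  simp only [Set.encard]
  rw [ENat.card_congr (Equiv.Set.univPi S), key]

/-- The number of injective tuples is the limit of numbers of tuples separated by dyadic
intervals. -/
lemma encard_injective_tuples {n : ℕ} {A : ℕ → Fin n → Set ℝ} (hA : Monotone A) :
    (({x : Fin n → ℝ | Function.Injective x ∧ ∀ i, x i ∈ ⋃ m, A m i}.encard : ℕ∞) : ℝ≥0∞) =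
      ⨆ m, ∑' J : {J : Fin n → ℤ // Function.Injective J},
        ∏ i, (((A m i ∩ dyadicCell m ⁻¹' {J.1 i}).encard : ℕ∞) : ℝ≥0∞) := by
  -- Counting measure on the discrete σ-algebra: continuity from below and countable additivity
  -- become available for arbitrary sets of tuples.
  have h1 : ∀ s : Set (Fin n → ℝ), ((s.encard : ℕ∞) : ℝ≥0∞) = @Measure.count _ ⊤ s := fun s =>
    (@Measure.count_apply _ ⊤ s trivial).symm
  rw [← iUnion_separatedTuples hA, h1,
    @Monotone.measure_iUnion _ _ ⊤ _ _ _ _ _ (monotone_separatedTuples hA)]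
  congr 1; ext m
  rw [separatedTuples_eq_iUnion, @measure_iUnion _ _ ⊤ _ _ _ (pairwise_disjoint_dyadic_pi _ m)
    (fun _ => trivial)]
  congr 1; ext J
  rw [← h1, encard_univ_pi]
  exact map_prod ENat.toENNRealRingHom _ _

/-- The non-injective tuples lie in a finite union of the proper hyperplanes $x_i=x_j$. -/
lemma volume_not_injective (n : ℕ) : volume {x : Fin n → ℝ | ¬ Function.Injective x} = 0 := by
  have hsub : {x : Fin n → ℝ | ¬ Function.Injective x} ⊆
      ⋃ p : {p : Fin n × Fin n // p.1 ≠ p.2}, {x | x p.1.1 = x p.1.2} := by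
    intro x hx
    simp only [Function.Injective, Set.mem_ofPred_eq, not_forall] at hx
    obtain ⟨i, j, hij, hne⟩ := hx
    exact Set.mem_iUnion.mpr ⟨⟨(i, j), hne⟩, hij⟩
  refine measure_mono_null hsub (measure_iUnion_null fun ⟨⟨i, j⟩, hne⟩ => ?_)
  let L : (Fin n → ℝ) →ₗ[ℝ] ℝ :=
    LinearMap.proj (R := ℝ) (φ := fun _ : Fin n => ℝ) i - LinearMap.proj (R := ℝ) (φ := fun _ : Fin n => ℝ) j
  have hL : {x : Fin n → ℝ | x i = x j} = (LinearMap.ker L : Set (Fin n → ℝ)) := by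
    ext x; simp [L, sub_eq_zero]
  change volume {x : Fin n → ℝ | x i = x j} = 0
  rw [hL]
  refine Measure.addHaar_submodule _ _ fun htop => ?_
  have h1 : Pi.single i (1 : ℝ) ∈ LinearMap.ker L := htop ▸ Submodule.mem_top
  have h2 : L (Pi.single i (1 : ℝ)) = 1 := by
    have : j ≠ i := fun h => hne h.symm
    simp [L, Pi.single_eq_of_ne this]
  rw [LinearMap.mem_ker, h2] at h1
  exact one_ne_zero h1

/-- The counterpart of `encard_injective_tuples` for integrals: the same exhaustion by boxes with
disjoint sides, valid because the diagonals are null. -/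
lemma setLIntegral_injective_tuples {n : ℕ} {A : ℕ → Fin n → Set ℝ} (hA : Monotone A)
    (hAm : ∀ m i, MeasurableSet (A m i)) (f : (Fin n → ℝ) → ℝ≥0∞) :
    ∫⁻ x in Set.univ.pi fun i => ⋃ m, A m i, f x =
      ⨆ m, ∑' J : {J : Fin n → ℤ // Function.Injective J},
        ∫⁻ x in Set.univ.pi fun i => A m i ∩ dyadicCell m ⁻¹' {J.1 i}, f x := by
  have hmeas : ∀ m (J : {J : Fin n → ℤ // Function.Injective J}),
      MeasurableSet (Set.univ.pi fun i => A m i ∩ dyadicCell m ⁻¹' {J.1 i}) := fun m J =>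
    MeasurableSet.univ_pi fun i =>
      (hAm m i).inter (measurable_dyadicCell m (measurableSet_singleton _))
  have hae : (Set.univ.pi fun i => ⋃ m, A m i) =ᵐ[volume] ⋃ m, separatedTuples (A m) m := by
    rw [iUnion_separatedTuples hA]
    have h0 : ∀ᵐ x : Fin n → ℝ, Function.Injective x := by
      rw [ae_iff]; exact volume_not_injective n
    filter_upwards [h0] with x hx
    exact propext ⟨fun h => ⟨hx, fun i => h i trivial⟩, fun h i _ => h.2 i⟩
  rw [setLIntegral_congr hae]
  rw [setLIntegral_iUnion_of_directed _ (monotone_separatedTuples hA).directed_le]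
  congr 1; ext m
  rw [separatedTuples_eq_iUnion, lintegral_iUnion (hmeas m) (pairwise_disjoint_dyadic_pi _ m)]

/-! ### Testing correlation functions on disjoint sets -/

section PointProcess

variable {Ω : Type*} [MeasurableSpace Ω] {X : Ω → Set ℝ} {P : Measure Ω}

lemma IsPointProcess.aemeasurable_prod_count (hX : IsPointProcess X P) {n : ℕ}
    {A : Fin n → Set ℝ} (hA : ∀ i, MeasurableSet (A i)) :
    AEMeasurable (fun ω => ∏ i, (((X ω ∩ A i).encard : ℕ∞) : ℝ≥0∞)) P :=
  Finset.aemeasurable_fun_prod _ fun i _ =>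
    measurable_from_top.comp_aemeasurable (hX.aemeasurable_count _ (hA i))

/-- To identify a correlation function it suffices to test it on products of pairwise disjoint sets
taken from an exhaustion `B` of the space. -/
theorem IsCorrelationFunction.of_disjoint (hX : IsPointProcess X P) {n : ℕ}
    {ρ : (Fin n → ℝ) → ℝ} (hρ : Measurable ρ) (hρ0 : ∀ x, 0 ≤ ρ x) {B : ℕ → Set ℝ}
    (hB : Monotone B) (hBm : ∀ m, MeasurableSet (B m)) (hXB : ∀ᵐ ω ∂P, X ω ⊆ ⋃ m, B m)
    (hρB : ∀ x, ρ x ≠ 0 → ∀ i, x i ∈ ⋃ m, B m)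
    (h : ∀ A : Fin n → Set ℝ, (∀ i, MeasurableSet (A i)) →
      Pairwise (fun i j => Disjoint (A i) (A j)) → (∃ m, ∀ i, A i ⊆ B m) →
      ∫⁻ ω, ∏ i, (((X ω ∩ A i).encard : ℕ∞) : ℝ≥0∞) ∂P =
        ∫⁻ x in Set.univ.pi A, ENNReal.ofReal (ρ x)) :
    IsCorrelationFunction X P n ρ := by
  -- Each `A i` is cut by `B m` and by the dyadic cells of level `m`. Injective labels `J` give
  -- boxes with pairwise disjoint sides, to which `h` applies; monotone convergence in `m` then
  -- recovers both sides.
  refine ⟨hρ, hρ0, fun A hA => ?_⟩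
  have hC : Monotone fun m i => A i ∩ B m := fun m m' hm i => Set.inter_subset_inter_right _ (hB hm)
  have hCm : ∀ m i, MeasurableSet (A i ∩ B m) := fun m i => (hA i).inter (hBm m)
  have hQ : ∀ m (J : {J : Fin n → ℤ // Function.Injective J}) (i : Fin n),
      MeasurableSet (A i ∩ B m ∩ dyadicCell m ⁻¹' {J.1 i}) := fun m J i =>
    (hCm m i).inter (measurable_dyadicCell m (measurableSet_singleton _))
  have hL : ∀ᵐ ω ∂P,
      (({x : Fin n → ℝ | Function.Injective x ∧ ∀ i, x i ∈ X ω ∩ A i}.encard : ℕ∞) : ℝ≥0∞) =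
      ⨆ m, ∑' J : {J : Fin n → ℤ // Function.Injective J},
        ∏ i, (((X ω ∩ (A i ∩ B m ∩ dyadicCell m ⁻¹' {J.1 i})).encard : ℕ∞) : ℝ≥0∞) := by
    filter_upwards [hXB] with ω hω
    have hmono : Monotone fun m i => X ω ∩ (A i ∩ B m) :=
      fun m m' hm i => Set.inter_subset_inter_right _ (hC hm i)
    have := encard_injective_tuples hmono
    simp only [Set.inter_assoc] at this ⊢
    rw [← this]
    congr 3
    ext x
    refine and_congr_right fun _ => forall_congr' fun i => ?_
    simp only [Set.mem_inter_iff, Set.mem_iUnion, exists_and_left]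
    exact and_congr_right fun hx => (and_iff_left_of_imp
      fun _ => by simpa using hω hx).symm
  have hR : ∫⁻ x in Set.univ.pi A, ENNReal.ofReal (ρ x) =
      ∫⁻ x in Set.univ.pi fun i => ⋃ m, A i ∩ B m, ENNReal.ofReal (ρ x) := by
    rw [← lintegral_indicator (MeasurableSet.univ_pi hA),
      ← lintegral_indicator (MeasurableSet.univ_pi fun i => MeasurableSet.iUnion fun m => hCm m i)]
    refine lintegral_congr fun x => ?_
    by_cases hx : ρ x = 0
    · simp [Set.indicator, hx]
    · have : x ∈ Set.univ.pi A ↔ x ∈ Set.univ.pi fun i => ⋃ m, A i ∩ B m := by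
        simp only [Set.mem_univ_pi, ← Set.inter_iUnion]
        exact forall_congr' fun i => (and_iff_left (hρB x hx i)).symm
      classical
      rw [Set.indicator_apply, Set.indicator_apply]
      exact if_congr this rfl rfl
  rw [lintegral_congr_ae hL, lintegral_iSup', hR, setLIntegral_injective_tuples hC hCm]
  · congr 1; ext m
    rw [lintegral_tsum fun J => hX.aemeasurable_prod_count (hQ m J)]
    congr 1; ext J
    refine h _ (hQ m J) (fun i j hij => ?_) ⟨m, fun i x hx => hx.1.2⟩
    exact Set.disjoint_left.mpr fun x hx hx' => hij (J.2 (hx.2.symm.trans hx'.2))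
  · exact fun m => AEMeasurable.tsum fun J => hX.aemeasurable_prod_count (hQ m J)
  · refine Eventually.of_forall fun ω m m' hm => ?_
    have hmono : Monotone fun m i => X ω ∩ (A i ∩ B m) :=
      fun m m' hm i => Set.inter_subset_inter_right _ (hC hm i)
    -- The sum over labels is the number of separated tuples, which makes its growth in `m` visible.
    have h1 : ∀ m, ∑' J : {J : Fin n → ℤ // Function.Injective J},
        ∏ i, (((X ω ∩ (A i ∩ B m ∩ dyadicCell m ⁻¹' {J.1 i})).encard : ℕ∞) : ℝ≥0∞) =
        (((separatedTuples (fun i => X ω ∩ (A i ∩ B m)) m).encard : ℕ∞) : ℝ≥0∞) := by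
      intro m
      rw [← @Measure.count_apply _ ⊤ _ trivial, separatedTuples_eq_iUnion,
        @measure_iUnion _ _ ⊤ _ _ _ (pairwise_disjoint_dyadic_pi _ m) (fun _ => trivial)]
      congr 1; ext J
      rw [@Measure.count_apply _ ⊤ _ trivial, encard_univ_pi]
      simp only [Set.inter_assoc]
      exact (map_prod ENat.toENNRealRingHom _ _).symm
    simp only [h1]
    exact_mod_cast Set.encard_le_encard (monotone_separatedTuples hmono hm)

end PointProcess

/-! ### Change of variable and uniqueness of correlation functions -/

section CorrelationFunction

variable {Ω : Type*} [MeasurableSpace Ω] {X : Ω → Set ℝ} {P : Measure Ω}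

lemma IsCorrelationFunction.congr_set {X' : Ω → Set ℝ} {n : ℕ} {ρ : (Fin n → ℝ) → ℝ}
    (h : IsCorrelationFunction X P n ρ) (hX : ∀ᵐ ω ∂P, X ω = X' ω) :
    IsCorrelationFunction X' P n ρ := by
  refine ⟨h.measurable, h.nonneg, fun A hA => ?_⟩
  rw [← h.lintegral_count A hA]
  refine lintegral_congr_ae ?_
  filter_upwards [hX] with ω hω
  rw [hω]

/-- The correlation function of the image of a point process under a change of variable. -/
theorem IsCorrelationFunction.image {n : ℕ} {ρ : (Fin n → ℝ) → ℝ}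
    (hρ : IsCorrelationFunction X P n ρ) {D : Set ℝ} (hD : MeasurableSet D) {φ φ' ψ : ℝ → ℝ}
    (hφ : ∀ x ∈ D, HasDerivWithinAt φ (φ' x) D x) (hφ' : Measurable φ')
    (h0 : ∀ x ∈ D, φ' x ≠ 0) (hinj : Set.InjOn φ D) (hψ : Measurable ψ)
    (hψφ : ∀ x ∈ D, ψ (φ x) = x) (hXD : ∀ᵐ ω ∂P, X ω ⊆ D) :
    IsCorrelationFunction (fun ω => φ '' X ω) P n
      ((Set.univ.pi fun _ => φ '' D).indicator
        fun ξ => ρ (fun i => ψ (ξ i)) * ∏ i, |φ' (ψ (ξ i))|⁻¹) := by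
  have hcont : ContinuousOn φ D := fun x hx => (hφ x hx).continuousWithinAt
  have hE : MeasurableSet (φ '' D) := hD.image_of_continuousOn_injOn hcont hinj
  have hEn : MeasurableSet (Set.univ.pi fun _ : Fin n => φ '' D) := MeasurableSet.univ_pi fun _ => hE
  refine ⟨?_, ?_, fun A hA => ?_⟩
  · refine Measurable.indicator ?_ hEn
    have := hρ.measurable
    fun_prop
  · exact fun ξ => Set.indicator_nonneg (fun ξ _ => mul_nonneg (hρ.nonneg _)
      (Finset.prod_nonneg fun i _ => by positivity)) ξ
  let A' : Fin n → Set ℝ := fun i => D ∩ φ ⁻¹' A i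
  have hA' : ∀ i, MeasurableSet (A' i) := by
    intro i
    have h1 := hD.subtype_image ((hcont.measurableEmbedding hD hinj).measurable (hA i))
    convert h1 using 1
    ext x
    simp [A', and_comm]
  have hcount : ∀ᵐ ω ∂P,
      (({x : Fin n → ℝ | Function.Injective x ∧ ∀ i, x i ∈ φ '' X ω ∩ A i}.encard : ℕ∞) : ℝ≥0∞) =
      (({x : Fin n → ℝ | Function.Injective x ∧ ∀ i, x i ∈ X ω ∩ A' i}.encard : ℕ∞) : ℝ≥0∞) := by
    filter_upwards [hXD] with ω hω
    have himg : {x : Fin n → ℝ | Function.Injective x ∧ ∀ i, x i ∈ φ '' X ω ∩ A i} =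
        (fun y i => φ (y i)) ''
          {x : Fin n → ℝ | Function.Injective x ∧ ∀ i, x i ∈ X ω ∩ A' i} := by
      ext x
      constructor
      · rintro ⟨hx, hxA⟩
        choose y hy using fun i => (hxA i).1
        have hyx : (fun i => φ (y i)) = x := funext fun i => (hy i).2
        refine ⟨y, ⟨fun i j hij => hx ?_, fun i => ⟨(hy i).1, hω (hy i).1, ?_⟩⟩, hyx⟩
        · rw [← (hy i).2, ← (hy j).2, hij]
        · change φ (y i) ∈ A i
          rw [(hy i).2]; exact (hxA i).2
      · rintro ⟨y, ⟨hy, hyA⟩, rfl⟩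
        exact ⟨fun i j hij => hy (hinj (hyA i).2.1 (hyA j).2.1 hij),
          fun i => ⟨⟨y i, (hyA i).1, rfl⟩, (hyA i).2.2⟩⟩
    rw [himg, Set.InjOn.encard_image]
    intro y hy y' hy' h
    exact funext fun i => hinj (hy.2 i).2.1 (hy'.2 i).2.1 (congrFun h i)
  rw [lintegral_congr_ae hcount, hρ.lintegral_count A' hA']
  have hS : MeasurableSet (Set.univ.pi A') := MeasurableSet.univ_pi hA'
  let Φ : (Fin n → ℝ) → (Fin n → ℝ) := fun x i => φ (x i)
  let Φ' : (Fin n → ℝ) → (Fin n → ℝ) →L[ℝ] (Fin n → ℝ) := fun x =>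
    ContinuousLinearMap.pi fun i =>
      (ContinuousLinearMap.toSpanSingleton ℝ (φ' (x i))).comp (ContinuousLinearMap.proj i)
  have hdet : ∀ x, (Φ' x).det = ∏ i, φ' (x i) := by
    intro x
    rw [ContinuousLinearMap.det_pi]
    refine Finset.prod_congr rfl fun i _ => ?_
    rw [ContinuousLinearMap.det, LinearMap.det_ring]
    simp
  have hder : ∀ x ∈ Set.univ.pi A', HasFDerivWithinAt Φ (Φ' x) (Set.univ.pi A') x := by
    intro x hx
    rw [hasFDerivWithinAt_pi]
    intro i
    exact ((hφ (x i) (hx i trivial).1).hasFDerivWithinAt).comp x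
      (ContinuousLinearMap.proj (R := ℝ) (φ := fun _ : Fin n => ℝ) i).hasFDerivWithinAt
      (fun y hy => (hy i trivial).1)
  have hinjΦ : Set.InjOn Φ (Set.univ.pi A') := fun y hy y' hy' h =>
    funext fun i => hinj (hy i trivial).1 (hy' i trivial).1 (congrFun h i)
  have himage : Φ '' Set.univ.pi A' = (Set.univ.pi A) ∩ Set.univ.pi fun _ => φ '' D := by
    have h1 := Set.piMap_image_univ_pi (fun _ : Fin n => φ) A'
    have h2 : Φ = Pi.map fun _ => φ := rfl
    rw [h2, h1, ← Set.pi_inter_distrib]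
    congr 1; ext i y
    constructor
    · rintro ⟨x, hx, rfl⟩
      exact ⟨hx.2, x, hx.1, rfl⟩
    · rintro ⟨hy, x, hx, rfl⟩
      exact ⟨x, ⟨hx, hy⟩, rfl⟩
  have hind : ∀ ξ : Fin n → ℝ, ENNReal.ofReal ((Set.univ.pi fun _ => φ '' D).indicator
        (fun ξ => ρ (fun i => ψ (ξ i)) * ∏ i, |φ' (ψ (ξ i))|⁻¹) ξ) =
      (Set.univ.pi fun _ => φ '' D).indicator
        (fun ξ => ENNReal.ofReal (ρ (fun i => ψ (ξ i)) * ∏ i, |φ' (ψ (ξ i))|⁻¹)) ξ := by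
    intro ξ
    by_cases hξ : ξ ∈ Set.univ.pi fun _ => φ '' D
    · rw [Set.indicator_of_mem hξ, Set.indicator_of_mem hξ]
    · rw [Set.indicator_of_notMem hξ, Set.indicator_of_notMem hξ, ENNReal.ofReal_zero]
  simp only [hind]
  rw [setLIntegral_indicator hEn, Set.inter_comm, ← himage,
    lintegral_image_eq_lintegral_abs_det_fderiv_mul volume hS hder hinjΦ]
  refine setLIntegral_congr_fun hS fun x hx => ?_
  have hψx : ∀ i, ψ (φ (x i)) = x i := fun i => hψφ _ (hx i trivial).1
  simp only [Φ, hψx, hdet]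
  rw [← ENNReal.ofReal_mul (abs_nonneg _), Finset.abs_prod, mul_left_comm,
    ← Finset.prod_mul_distrib, Finset.prod_eq_one, mul_one]
  intro i _
  exact mul_inv_cancel₀ (abs_ne_zero.mpr (h0 _ (hx i trivial).1))

/-- Correlation functions are determined up to null sets. -/
theorem IsCorrelationFunction.ae_eq {n : ℕ} {ρ ρ' : (Fin n → ℝ) → ℝ}
    (h : IsCorrelationFunction X P n ρ) (h' : IsCorrelationFunction X P n ρ') {B : ℕ → Set ℝ}
    (hB : Monotone B) (hBm : ∀ m, MeasurableSet (B m)) (hBu : ⋃ m, B m = Set.univ)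
    (hfin : ∀ m, ∫⁻ x in Set.univ.pi fun _ => B m, ENNReal.ofReal (ρ x) ≠ ∞) :
    ρ =ᵐ[volume] ρ' := by
  have hmeas : ∀ {A : Fin n → Set ℝ}, (∀ i, MeasurableSet (A i)) → MeasurableSet (Set.univ.pi A) :=
    fun hA => MeasurableSet.univ_pi hA
  -- The two densities give measures that agree on the π-system of boxes and are finite on the
  -- exhausting cubes of `B m`.
  have heq : (volume : Measure (Fin n → ℝ)).withDensity (fun x => ENNReal.ofReal (ρ x)) =
      volume.withDensity fun x => ENNReal.ofReal (ρ' x) := by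
    refine Measure.ext_of_generateFrom_of_iUnion
      (Set.pi Set.univ '' Set.pi Set.univ fun _ => {s : Set ℝ | MeasurableSet s})
      (fun m => Set.univ.pi fun _ => B m) generateFrom_pi.symm isPiSystem_pi ?_ ?_ ?_ ?_
    · refine Set.eq_univ_of_forall fun x => ?_
      choose m hm using fun i => Set.mem_iUnion.mp (hBu ▸ Set.mem_univ (x i) : x i ∈ ⋃ m, B m)
      exact Set.mem_iUnion.mpr ⟨Finset.univ.sup m,
        fun i _ => hB (Finset.le_sup (Finset.mem_univ i)) (hm i)⟩
    · exact fun m => ⟨fun _ => B m, fun _ _ => hBm m, rfl⟩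
    · intro m
      rw [withDensity_apply _ (hmeas fun _ => hBm m)]
      exact hfin m
    · rintro _ ⟨A, hA, rfl⟩
      have hA' : ∀ i, MeasurableSet (A i) := fun i => hA i trivial
      rw [withDensity_apply _ (hmeas hA'), withDensity_apply _ (hmeas hA'),
        ← h.lintegral_count A hA', ← h'.lintegral_count A hA']
  rw [withDensity_eq_iff_of_sigmaFinite h.measurable.ennreal_ofReal.aemeasurable
    h'.measurable.ennreal_ofReal.aemeasurable] at heq
  filter_upwards [heq] with x hx
  exact (ENNReal.ofReal_eq_ofReal_iff (h.nonneg x) (h'.nonneg x)).mp hx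

end CorrelationFunction

/-! ### Correlation functions of the Poisson process -/

section Poisson

/-- The weights satisfy $(n+1)p_{n+1}=r\,p_n$, so the mean is $r$ times the total mass. -/
lemma lintegral_natCast_poissonMeasure (r : NNReal) :
    ∫⁻ n : ℕ, (n : ℝ≥0∞) ∂(poissonMeasure r) = r := by
  have hsum := hasSum_one_poissonMeasure r
  have h1 : ∑' n : ℕ, ENNReal.ofReal (Real.exp (-r) * r ^ n / n.factorial) = 1 := by
    rw [← ENNReal.ofReal_tsum_of_nonneg (fun n => by positivity) hsum.summable, hsum.tsum_eq,
      ENNReal.ofReal_one]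
  rw [lintegral_countable']
  simp only [poissonMeasure_singleton]
  rw [tsum_eq_zero_add' ENNReal.summable]
  simp only [Nat.cast_zero, zero_mul, zero_add]
  have h2 : ∀ n : ℕ, ((n + 1 : ℕ) : ℝ≥0∞) *
      ENNReal.ofReal (Real.exp (-r) * r ^ (n + 1) / (n + 1).factorial) =
      r * ENNReal.ofReal (Real.exp (-r) * r ^ n / n.factorial) := by
    intro n
    rw [← ENNReal.ofReal_natCast, ← ENNReal.ofReal_coe_nnreal, ← ENNReal.ofReal_mul (by positivity),
      ← ENNReal.ofReal_mul (by positivity), Nat.factorial_succ]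
    congr 1
    push_cast
    rw [pow_succ]
    field_simp
  simp only [h2]
  rw [ENNReal.tsum_mul_left, h1, mul_one]

variable {Ω : Type*} [MeasurableSpace Ω] {Y : Ω → Set ℝ} {P : Measure Ω}

lemma IsPoissonProcess.lintegral_encard {ν : Measure ℝ} (hY : IsPoissonProcess Y P ν) {A : Set ℝ}
    (hA : MeasurableSet A) (hfin : ν A ≠ ∞) :
    ∫⁻ ω, (((Y ω ∩ A).encard : ℕ∞) : ℝ≥0∞) ∂P = ν A := by
  have h := hY.law A hA hfin
  have hm : Measurable (fun k : ℕ∞ => (k : ℝ≥0∞)) := measurable_from_top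
  rw [← lintegral_map' hm.aemeasurable h.aemeasurable, h.map_eq, lintegral_map hm measurable_from_top]
  simp only [ENat.toENNReal_coe]
  rw [lintegral_natCast_poissonMeasure, ENNReal.coe_toNNReal hfin]

/-- All correlation functions of the Poisson process of constant density `1` equal `1`. -/
theorem IsPoissonProcess.isCorrelationFunction_one [IsProbabilityMeasure P]
    (hY : IsPoissonProcess Y P volume) (n : ℕ) : IsCorrelationFunction Y P n fun _ => 1 := by
  have hcover : ∀ x : ℝ, x ∈ ⋃ m : ℕ, Set.Icc (-(m : ℝ)) m := by
    intro x
    obtain ⟨m, hm⟩ := exists_nat_ge |x|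
    exact Set.mem_iUnion.mpr ⟨m, abs_le.mp hm⟩
  refine IsCorrelationFunction.of_disjoint hY.isPointProcess measurable_const
    (fun _ => zero_le_one) (B := fun m => Set.Icc (-(m : ℝ)) m) ?_ (fun _ => measurableSet_Icc)
    (Eventually.of_forall fun ω x _ => hcover x) (fun x _ i => hcover (x i)) ?_
  · intro m m' hm
    have : (m : ℝ) ≤ m' := by exact_mod_cast hm
    exact Set.Icc_subset_Icc (neg_le_neg this) this
  · rintro A hA hdisj ⟨m, hm⟩
    have hfin : ∀ i, volume (A i) ≠ ∞ := fun i =>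
      ((measure_mono (hm i)).trans_lt measure_Icc_lt_top).ne
    have hind := (hY.indep n A hA hfin hdisj).comp (fun _ (k : ℕ∞) => (k : ℝ≥0∞))
      (fun _ => measurable_from_top)
    have hae : ∀ i, AEMeasurable ((fun k : ℕ∞ => (k : ℝ≥0∞)) ∘ fun ω => (Y ω ∩ A i).encard) P :=
      fun i => measurable_from_top.comp_aemeasurable (hY.isPointProcess.aemeasurable_count _ (hA i))
    -- The counts are only almost everywhere measurable, so the product formula is applied to
    -- measurable representatives.
    have hind' := hind.congr fun i => (hae i).ae_eq_mk
    have hprod := lintegral_prod_eq_prod_lintegral_of_indepFun Finset.univ _ hind'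
      fun i => (hae i).measurable_mk
    have h1 : ∫⁻ ω, ∏ i, (((Y ω ∩ A i).encard : ℕ∞) : ℝ≥0∞) ∂P =
        ∫⁻ ω, ∏ i, (hae i).mk _ ω ∂P := by
      refine lintegral_congr_ae ?_
      filter_upwards [eventually_countable_forall.mpr fun i => (hae i).ae_eq_mk] with ω hω
      exact Finset.prod_congr rfl fun i _ => hω i
    rw [h1, hprod]
    simp only [ENNReal.ofReal_one, lintegral_one, Measure.restrict_apply_univ]
    rw [volume_pi_pi]
    refine Finset.prod_congr rfl fun i _ => ?_
    rw [← hY.lintegral_encard (hA i) (hfin i)]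
    exact lintegral_congr_ae (hae i).ae_eq_mk.symm

end Poisson

/-! ### Recovering Poisson laws from factorial moments -/

/-- Inversion of factorial moments of a Poisson distribution. -/
lemma eq_poisson_of_hasSum_choose {q : ℕ → ℝ} (hq : ∀ n, 0 ≤ q n) {c a : ℝ}
    (h : ∀ k : ℕ, HasSum (fun n => q n * (n.choose k : ℝ)) (c * (a ^ k / k.factorial))) (k : ℕ) :
    q k = c * (Real.exp (-a) * a ^ k / k.factorial) := by
  -- The double array of the inversion $q_k=\sum_j(-1)^j\binom{k+j}{k}\sum_n q_n\binom{n}{k+j}$.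
  -- Summing over `n` first gives the prescribed moments, hence the series of $e^{-a}$; summing over
  -- `j` first leaves only $q_k$. The exponential series for $a$ makes the array absolutely
  -- summable.
  let F : ℕ → ℕ → ℝ := fun j n => (-1) ^ j * ((k + j).choose k : ℝ) * (q n * (n.choose (k + j) : ℝ))
  have hcoef : ∀ j : ℕ, ((k + j).choose k : ℝ) * (c * (a ^ (k + j) / (k + j).factorial)) =
      c * (a ^ k / k.factorial) * (a ^ j / j.factorial) := by
    intro j
    have h1 : ((k + j).choose k : ℝ) = (k + j).factorial / (k.factorial * j.factorial) :=
      Nat.cast_add_choose ℝ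
    rw [h1, pow_add]
    field_simp
  have hsumF : Summable (Function.uncurry F) := by
    refine Summable.of_norm ?_
    have hnorm : ∀ p : ℕ × ℕ, ‖Function.uncurry F p‖ =
        ((k + p.1).choose k : ℝ) * (q p.2 * (p.2.choose (k + p.1) : ℝ)) := by
      rintro ⟨j, n⟩
      change ‖F j n‖ = ((k + j).choose k : ℝ) * (q n * (n.choose (k + j) : ℝ))
      have h0 : 0 ≤ ((k + j).choose k : ℝ) * (q n * (n.choose (k + j) : ℝ)) :=
        mul_nonneg (Nat.cast_nonneg _) (mul_nonneg (hq _) (Nat.cast_nonneg _))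
      have h1 : F j n = (-1) ^ j * (((k + j).choose k : ℝ) * (q n * (n.choose (k + j) : ℝ))) :=
        mul_assoc _ _ _
      rw [h1, norm_mul, norm_pow, norm_neg, norm_one, one_pow, one_mul, Real.norm_of_nonneg h0]
    have h1 : ∀ j : ℕ, HasSum (fun n => ((k + j).choose k : ℝ) * (q n * (n.choose (k + j) : ℝ)))
        (c * (a ^ k / k.factorial) * (a ^ j / j.factorial)) := fun j => by
      rw [← hcoef]
      exact (h (k + j)).mul_left ((k + j).choose k : ℝ)
    have h2 : Summable fun p : ℕ × ℕ =>
        ((k + p.1).choose k : ℝ) * (q p.2 * (p.2.choose (k + p.1) : ℝ)) := by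
      rw [summable_prod_of_nonneg fun p => mul_nonneg (Nat.cast_nonneg _)
        (mul_nonneg (hq _) (Nat.cast_nonneg _))]
      refine ⟨fun j => (h1 j).summable, ?_⟩
      simp only [fun j => (h1 j).tsum_eq]
      exact (Real.summable_pow_div_factorial a).mul_left _
    exact h2.congr fun p => (hnorm p).symm
  have hcomm := hsumF.tsum_comm
  have hleft : ∀ j, ∑' n, F j n = c * (a ^ k / k.factorial) * ((-a) ^ j / j.factorial) := by
    intro j
    simp only [F]
    rw [tsum_mul_left, (h (k + j)).tsum_eq, mul_assoc, hcoef, neg_pow a j]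
    ring
  -- From $\binom{n}{k+j}\binom{k+j}{k}=\binom nk\binom{n-k}{j}$, what remains is the alternating
  -- sum of the row $n-k$, which is zero unless $n=k$.
  have hright : ∀ n, ∑' j, F j n = if n = k then q k else 0 := by
    intro n
    rcases lt_or_ge n k with hnk | hnk
    · rw [if_neg hnk.ne]
      have : ∀ j, F j n = 0 := fun j => by
        simp only [F, Nat.choose_eq_zero_of_lt (hnk.trans_le (Nat.le_add_right k j)),
          Nat.cast_zero, mul_zero]
      simp [this]
    · have h1 : ∀ j, F j n = q n * (n.choose k : ℝ) * ((-1) ^ j * ((n - k).choose j : ℝ)) := by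
        intro j
        have h2 := @Nat.choose_mul n (k + j) k (Nat.le_add_right k j)
        rw [Nat.add_sub_cancel_left] at h2
        have h3 : (n.choose (k + j) : ℝ) * ((k + j).choose k : ℝ) =
          (n.choose k : ℝ) * ((n - k).choose j : ℝ) := by exact_mod_cast h2
        simp only [F]
        linear_combination (-1) ^ j * q n * h3
      have h4 : ∑' j : ℕ, ((-1) ^ j * ((n - k).choose j : ℝ)) = if n - k = 0 then 1 else 0 := by
        rw [tsum_eq_sum (s := Finset.range (n - k + 1))]
        · exact_mod_cast congrArg (Int.cast : ℤ → ℝ)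
            (Int.alternating_sum_range_choose (n := n - k))
        · intro j hj
          rw [Nat.choose_eq_zero_of_lt (by simpa using hj), Nat.cast_zero, mul_zero]
      simp only [h1]
      rw [tsum_mul_left, h4]
      by_cases hn : n = k
      · subst hn; simp
      · rw [if_neg hn, if_neg (by omega), mul_zero]
  simp only [hleft, hright] at hcomm
  have hexp : ∑' j : ℕ, (-a) ^ j / (j.factorial : ℝ) = Real.exp (-a) := by
    rw [Real.exp_eq_exp_ℝ]
    exact (NormedSpace.expSeries_div_hasSum_exp (-a)).tsum_eq
  rw [tsum_ite_eq, tsum_mul_left, hexp] at hcomm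
  rw [hcomm]
  ring

section FactorialMoments

variable {Ω : Type*} [MeasurableSpace Ω] {P : Measure Ω}

/-- Weighted factorial moments of Poisson type determine the weighted distribution. -/
lemma lintegral_mul_ite_eq_of_choose {W : Ω → ℝ≥0∞} (hW : AEMeasurable W P) {N : Ω → ℕ}
    (hN : AEMeasurable N P) {c a : ℝ} (hc : 0 ≤ c) (ha : 0 ≤ a)
    (h : ∀ k : ℕ, ∫⁻ ω, W ω * ((N ω).choose k : ℝ≥0∞) ∂P =
      ENNReal.ofReal (c * (a ^ k / k.factorial))) (k : ℕ) :
    ∫⁻ ω, W ω * (if N ω = k then 1 else 0) ∂P =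
      ENNReal.ofReal (c * (Real.exp (-a) * a ^ k / k.factorial)) := by
  have hm : ∀ n : ℕ, AEMeasurable (fun ω => W ω * (if N ω = n then 1 else 0)) P := fun n =>
    hW.mul ((measurable_from_top (f := fun j : ℕ => if j = n then (1 : ℝ≥0∞) else 0)).comp_aemeasurable
      hN)
  set Q : ℕ → ℝ≥0∞ := fun n => ∫⁻ ω, W ω * (if N ω = n then 1 else 0) ∂P with hQ
  have hsum : ∀ j : ℕ, ∑' n, Q n * (n.choose j : ℝ≥0∞) =
      ENNReal.ofReal (c * (a ^ j / j.factorial)) := by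
    intro j
    rw [← h j]
    have h1 : ∀ ω, W ω * ((N ω).choose j : ℝ≥0∞) =
        ∑' n : ℕ, W ω * (if N ω = n then 1 else 0) * (n.choose j : ℝ≥0∞) := by
      intro ω
      rw [tsum_eq_single (N ω)]
      · simp
      · intro n hn
        simp [hn.symm]
    simp only [h1]
    rw [lintegral_tsum fun n => (hm n).mul_const _]
    exact tsum_congr fun n => (lintegral_mul_const'' _ (hm n)).symm
  -- The zeroth moment bounds every `Q n`.
  have hfin : ∀ n, Q n ≠ ∞ := by
    intro n htop
    have h0 := hsum 0
    have : Q n * ((n.choose 0 : ℕ) : ℝ≥0∞) ≤ ENNReal.ofReal (c * (a ^ 0 / (0 : ℕ).factorial)) :=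
      h0 ▸ ENNReal.le_tsum n
    rw [htop] at this
    simp at this
  have hreal : ∀ j : ℕ, HasSum (fun n => (Q n).toReal * (n.choose j : ℝ))
      (c * (a ^ j / j.factorial)) := by
    intro j
    have h1 := ENNReal.hasSum_toReal (f := fun n => Q n * (n.choose j : ℝ≥0∞))
      (by rw [hsum j]; exact ENNReal.ofReal_ne_top)
    rw [← ENNReal.tsum_toReal_eq (fun n => ENNReal.mul_ne_top (hfin n) (ENNReal.natCast_ne_top _)),
      hsum j, ENNReal.toReal_ofReal (by positivity)] at h1
    simpa [ENNReal.toReal_mul] using h1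
  rw [← eq_poisson_of_hasSum_choose (fun n => ENNReal.toReal_nonneg) hreal k,
    ENNReal.ofReal_toReal (hfin k)]

/-- Random variables with the joint factorial moments of independent Poisson variables have the
joint distribution of independent Poisson variables. -/
lemma measure_eq_of_choose {m : ℕ} {N : Fin m → Ω → ℕ} (hN : ∀ i, AEMeasurable (N i) P)
    {a : Fin m → ℝ} (ha : ∀ i, 0 ≤ a i)
    (h : ∀ k : Fin m → ℕ, ∫⁻ ω, ∏ i, ((N i ω).choose (k i) : ℝ≥0∞) ∂P =
      ENNReal.ofReal (∏ i, a i ^ k i / (k i).factorial)) (k : Fin m → ℕ) :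
    P {ω | ∀ i, N i ω = k i} =
      ENNReal.ofReal (∏ i, Real.exp (-a i) * a i ^ k i / (k i).factorial) := by
  classical
  -- Interpolation between moments and probabilities: coordinates in `s` are already tested by exact
  -- value, the others still by a binomial coefficient. Adding `i₀` to `s` inverts one coordinate,
  -- the product over the others serving as the weight.
  let G : Finset (Fin m) → Fin m → ℕ → Ω → ℝ≥0∞ := fun s i l ω =>
    if i ∈ s then (if N i ω = l then 1 else 0) else ((N i ω).choose l : ℝ≥0∞)
  let g : Finset (Fin m) → Fin m → ℕ → ℝ := fun s i l =>
    if i ∈ s then Real.exp (-a i) * a i ^ l / l.factorial else a i ^ l / l.factorial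
  have hg : ∀ s i l, 0 ≤ g s i l := by
    intro s i l
    have := ha i
    simp only [g]; split_ifs <;> positivity
  have hG : ∀ s i l, AEMeasurable (G s i l) P := by
    intro s i l
    by_cases hi : i ∈ s
    · have := (measurable_from_top (f := fun j : ℕ => if j = l then (1 : ℝ≥0∞) else 0)).comp_aemeasurable
        (hN i)
      simpa only [G, hi, if_true, Function.comp_def] using this
    · have := (measurable_from_top (f := fun j : ℕ => (j.choose l : ℝ≥0∞))).comp_aemeasurable (hN i)
      simpa only [G, hi, if_false, Function.comp_def] using this
  have key : ∀ s : Finset (Fin m), ∀ k : Fin m → ℕ,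
      ∫⁻ ω, ∏ i, G s i (k i) ω ∂P = ENNReal.ofReal (∏ i, g s i (k i)) := by
    intro s
    induction s using Finset.induction_on with
    | empty => intro k; simpa [G, g] using h k
    | insert i₀ s hi₀ ih =>
      intro k
      have hne : ∀ i ∈ Finset.univ.erase i₀, (i ∈ insert i₀ s ↔ i ∈ s) := fun i hi => by
        simp [Finset.ne_of_mem_erase hi]
      have hsplit : ∀ (l : ℕ) ω, ∏ i, G s i (Function.update k i₀ l i) ω =
          (∏ i ∈ Finset.univ.erase i₀, G s i (k i) ω) * ((N i₀ ω).choose l : ℝ≥0∞) := by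
        intro l ω
        rw [← Finset.mul_prod_erase _ _ (Finset.mem_univ i₀), mul_comm]
        congr 1
        · exact Finset.prod_congr rfl fun i hi => by
            rw [Function.update_of_ne (Finset.ne_of_mem_erase hi)]
        · simp [G, hi₀]
      have hsplit' : ∀ l : ℕ, ∏ i, g s i (Function.update k i₀ l i) =
          (∏ i ∈ Finset.univ.erase i₀, g s i (k i)) * (a i₀ ^ l / l.factorial) := by
        intro l
        rw [← Finset.mul_prod_erase _ _ (Finset.mem_univ i₀), mul_comm]
        congr 1
        · exact Finset.prod_congr rfl fun i hi => by
            rw [Function.update_of_ne (Finset.ne_of_mem_erase hi)]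
        · simp [g, hi₀]
      have := lintegral_mul_ite_eq_of_choose (N := N i₀)
        (W := fun ω => ∏ i ∈ Finset.univ.erase i₀, G s i (k i) ω)
        (Finset.aemeasurable_fun_prod _ fun i _ => hG s i (k i)) (hN i₀)
        (Finset.prod_nonneg fun i _ => hg s i (k i)) (ha i₀)
        (fun l => by
          rw [← hsplit', ← ih]
          exact lintegral_congr fun ω => (hsplit l ω).symm) (k i₀)
      have hR : ∏ i, g (insert i₀ s) i (k i) = (∏ i ∈ Finset.univ.erase i₀, g s i (k i)) *
          (Real.exp (-a i₀) * a i₀ ^ k i₀ / (k i₀).factorial) := by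
        rw [← Finset.mul_prod_erase _ _ (Finset.mem_univ i₀), mul_comm]
        congr 1
        · exact Finset.prod_congr rfl fun i hi => by simp only [g, hne i hi]
        · simp [g]
      rw [hR, ← this]
      refine lintegral_congr fun ω => ?_
      rw [← Finset.mul_prod_erase _ _ (Finset.mem_univ i₀), mul_comm]
      congr 1
      · exact Finset.prod_congr rfl fun i hi => by simp only [G, hne i hi]
      · simp [G]
  have hset : NullMeasurableSet {ω | ∀ i, N i ω = k i} P := by
    have : {ω | ∀ i, N i ω = k i} = ⋂ i, N i ⁻¹' {k i} := by ext ω; simp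
    rw [this]
    exact NullMeasurableSet.iInter fun i => (hN i).nullMeasurableSet_preimage (measurableSet_singleton _)
  rw [← lintegral_indicator_one₀ hset]
  have h1 := key Finset.univ k
  simp only [g, Finset.mem_univ, if_true] at h1
  rw [← h1]
  refine lintegral_congr fun ω => ?_
  simp only [G, Finset.mem_univ, if_true, Set.indicator, Set.mem_ofPred_eq, Pi.one_apply]
  rw [Finset.prod_ite_zero]
  simp

/-- Because the `S i` are disjoint, collisions can only occur within one colour. The tuple is
therefore a free choice, for each `i`, of an injection of `k i` indices into `S i`. -/
lemma encard_injective_colored {m : ℕ} (k : Fin m → ℕ) {S : Fin m → Set ℝ}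
    (hS : ∀ i, (S i).Finite) (hdisj : Pairwise fun i j => Disjoint (S i) (S j)) :
    {x : Fin (∑ i, k i) → ℝ | Function.Injective x ∧
      ∀ j, x j ∈ S (finSigmaFinEquiv.symm j).1}.encard =
      ((∏ i, (S i).ncard.descFactorial (k i) : ℕ) : ℕ∞) := by
  have : ∀ i, Finite (S i) := hS
  have : ∀ i, Fintype (S i) := fun i => Fintype.ofFinite _
  let e := finSigmaFinEquiv (n := k)
  have hinj : ∀ (f : ∀ i, (Fin (k i) ↪ S i)) (p p' : (i : Fin m) × Fin (k i)),
      ((f p.1 p.2 : S p.1) : ℝ) = f p'.1 p'.2 → p = p' := by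
    rintro f ⟨i, l⟩ ⟨i', l'⟩ h
    by_cases hi : i = i'
    · subst hi
      have h1 : l = l' := (f i).injective (Subtype.ext h)
      rw [h1]
    · refine absurd (f i' l').2 (Set.disjoint_left.mp (hdisj hi) ?_)
      simp only at h
      exact h ▸ (f i l).2
  let E : {x : Fin (∑ i, k i) → ℝ | Function.Injective x ∧ ∀ j, x j ∈ S (e.symm j).1} ≃
      ∀ i, (Fin (k i) ↪ S i) :=
    { toFun := fun x i => ⟨fun l => ⟨x.1 (e ⟨i, l⟩), by simpa using x.2.2 (e ⟨i, l⟩)⟩, by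
        intro l l' h
        have h1 := e.injective (x.2.1 (congrArg Subtype.val h))
        simpa using h1⟩
      invFun := fun f => ⟨fun j => f (e.symm j).1 (e.symm j).2, by
        refine ⟨fun j j' h => ?_, fun j => (f (e.symm j).1 (e.symm j).2).2⟩
        exact e.symm.injective (hinj f _ _ h)⟩
      left_inv := fun x => by
        ext j
        change x.1 (e ⟨(e.symm j).1, (e.symm j).2⟩) = x.1 j
        rw [Sigma.eta, e.apply_symm_apply]
      right_inv := fun f => by
        funext i
        ext l
        have h1 : ∀ p : (i : Fin m) × Fin (k i), p = ⟨i, l⟩ → ((f p.1 p.2 : S p.1) : ℝ) = f i l := by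
          rintro _ rfl; rfl
        exact h1 _ (e.symm_apply_apply _) }
  rw [Set.encard, ENat.card_congr E, ENat.card_eq_coe_natCard, Nat.card_pi]
  congr 2
  ext i
  classical
  rw [Nat.card_eq_fintype_card, Fintype.card_embedding_eq, Fintype.card_fin,
    ← Nat.card_coe_set_eq, Nat.card_eq_fintype_card]

end FactorialMoments

/-! ### Constant correlation functions characterise the Poisson process -/

section PoissonCharacterization

variable {Ω : Type*} [MeasurableSpace Ω] {Y : Ω → Set ℝ} {P : Measure Ω}

lemma IsCorrelationFunction.congr_ae {n : ℕ} {ρ ρ' : (Fin n → ℝ) → ℝ}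
    (h : IsCorrelationFunction Y P n ρ) (hm : Measurable ρ') (h0 : ∀ x, 0 ≤ ρ' x)
    (hae : ρ =ᵐ[volume] ρ') : IsCorrelationFunction Y P n ρ' := by
  refine ⟨hm, h0, fun A hA => ?_⟩
  rw [h.lintegral_count A hA]
  refine lintegral_congr_ae ?_
  filter_upwards [ae_restrict_of_ae hae] with x hx
  rw [hx]

lemma IsCorrelationFunction.lintegral_encard {ρ : (Fin 1 → ℝ) → ℝ}
    (h : IsCorrelationFunction Y P 1 ρ) {A : Set ℝ} (hA : MeasurableSet A) :
    ∫⁻ ω, (((Y ω ∩ A).encard : ℕ∞) : ℝ≥0∞) ∂P =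
      ∫⁻ x in Set.univ.pi fun _ => A, ENNReal.ofReal (ρ x) := by
  rw [← h.lintegral_count (fun _ => A) fun _ => hA]
  refine lintegral_congr fun ω => ?_
  have h1 : {x : Fin 1 → ℝ | Function.Injective x ∧ ∀ i, x i ∈ Y ω ∩ A} =
      Set.univ.pi fun _ => Y ω ∩ A := by
    ext x
    simp only [Set.mem_ofPred_eq, Set.mem_univ_pi]
    exact and_iff_right (Function.injective_of_subsingleton x)
  rw [h1, encard_univ_pi]
  simp

lemma IsCorrelationFunction.ae_finite (hY : IsPointProcess Y P)
    (h : IsCorrelationFunction Y P 1 fun _ => 1) {A : Set ℝ} (hA : MeasurableSet A)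
    (hfin : volume A ≠ ∞) : ∀ᵐ ω ∂P, (Y ω ∩ A).Finite := by
  have h1 := h.lintegral_encard hA
  rw [ENNReal.ofReal_one, lintegral_one, Measure.restrict_apply_univ, volume_pi_pi] at h1
  have hm : AEMeasurable (fun ω => (((Y ω ∩ A).encard : ℕ∞) : ℝ≥0∞)) P :=
    measurable_from_top.comp_aemeasurable (hY.aemeasurable_count _ hA)
  have h2 := ae_lt_top' hm (by rw [h1]; simpa using hfin)
  filter_upwards [h2] with ω hω
  exact Set.encard_ne_top_iff.mp (ENat.toENNReal_lt_top.mp hω).ne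

/-- The correlation function of order $\sum k_i$ is tested on a box with `k i` sides equal to `A i`;
ordering the points accounts for the factorials. -/
lemma IsCorrelationFunction.lintegral_prod_choose (hY : IsPointProcess Y P)
    (h : ∀ n, IsCorrelationFunction Y P n fun _ => 1) {m : ℕ} {A : Fin m → Set ℝ}
    (hA : ∀ i, MeasurableSet (A i)) (hfin : ∀ i, volume (A i) ≠ ∞)
    (hdisj : Pairwise fun i j => Disjoint (A i) (A j)) (k : Fin m → ℕ) :
    ∫⁻ ω, ∏ i, (((Y ω ∩ A i).ncard.choose (k i) : ℕ) : ℝ≥0∞) ∂P =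
      ENNReal.ofReal (∏ i, (volume (A i)).toReal ^ k i / (k i).factorial) := by
  have hcount := (h (∑ i, k i)).lintegral_count (fun j => A (finSigmaFinEquiv.symm j).1)
    fun j => hA _
  rw [ENNReal.ofReal_one, lintegral_one, Measure.restrict_apply_univ, volume_pi_pi] at hcount
  have hR : ∏ j, volume (A (finSigmaFinEquiv (n := k).symm j).1) = ∏ i, volume (A i) ^ k i := by
    rw [Fintype.prod_equiv finSigmaFinEquiv.symm _
      (fun p : (i : Fin m) × Fin (k i) => volume (A p.1)) (fun _ => rfl), Fintype.prod_sigma]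
    simp
  have hL : ∀ᵐ ω ∂P, (({x : Fin (∑ i, k i) → ℝ | Function.Injective x ∧
      ∀ j, x j ∈ Y ω ∩ A (finSigmaFinEquiv.symm j).1}.encard : ℕ∞) : ℝ≥0∞) =
      (∏ i, ((k i).factorial : ℝ≥0∞)) *
        ∏ i, (((Y ω ∩ A i).ncard.choose (k i) : ℕ) : ℝ≥0∞) := by
    filter_upwards [eventually_countable_forall.mpr
      fun i => IsCorrelationFunction.ae_finite hY (h 1) (hA i) (hfin i)] with ω hω
    rw [encard_injective_colored k hω fun i j hij =>
      (hdisj hij).mono Set.inter_subset_right Set.inter_subset_right]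
    rw [ENat.toENNReal_coe, ← Finset.prod_mul_distrib, Nat.cast_prod]
    refine Finset.prod_congr rfl fun i _ => ?_
    rw [Nat.descFactorial_eq_factorial_mul_choose, Nat.cast_mul]
  have hm : AEMeasurable (fun ω => ∏ i, (((Y ω ∩ A i).ncard.choose (k i) : ℕ) : ℝ≥0∞)) P :=
    Finset.aemeasurable_fun_prod _ fun i _ =>
      (measurable_from_top (f := fun j : ℕ∞ => ((j.toNat.choose (k i) : ℕ) : ℝ≥0∞))).comp_aemeasurable
        (hY.aemeasurable_count _ (hA i))
  rw [lintegral_congr_ae hL, lintegral_const_mul'' _ hm, hR] at hcount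
  have hf0 : (∏ i, ((k i).factorial : ℝ≥0∞)) ≠ 0 :=
    Finset.prod_ne_zero_iff.mpr fun i _ => Nat.cast_ne_zero.mpr (Nat.factorial_ne_zero _)
  have hft : (∏ i, ((k i).factorial : ℝ≥0∞)) ≠ ∞ :=
    ENNReal.prod_ne_top fun i _ => ENNReal.natCast_ne_top _
  rw [← ENNReal.mul_right_inj hf0 hft, hcount, ENNReal.ofReal_prod_of_nonneg
    (fun i _ => by positivity), ← Finset.prod_mul_distrib]
  refine Finset.prod_congr rfl fun i _ => ?_
  rw [← ENNReal.ofReal_natCast, ← ENNReal.ofReal_mul (by positivity), mul_div_cancel₀ _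
    (by positivity), ENNReal.ofReal_pow ENNReal.toReal_nonneg, ENNReal.ofReal_toReal (hfin i)]

/-- A point process all of whose correlation functions equal `1` is the Poisson process of constant
density `1`. -/
theorem isPoissonProcess_of_isCorrelationFunction_one [IsProbabilityMeasure P]
    (hY : IsPointProcess Y P) (h : ∀ n, IsCorrelationFunction Y P n fun _ => 1) :
    IsPoissonProcess Y P volume := by
  have hjoint : ∀ (m : ℕ) (A : Fin m → Set ℝ), (∀ i, MeasurableSet (A i)) →
      (∀ i, volume (A i) ≠ ∞) → Pairwise (fun i j => Disjoint (A i) (A j)) →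
      P.map (fun ω i => (Y ω ∩ A i).encard) = Measure.pi fun i =>
        (poissonMeasure (volume (A i)).toNNReal).map (Nat.cast : ℕ → ℕ∞) := by
    intro m A hA hfin hdisj
    have hcm : ∀ i, AEMeasurable (fun ω => (Y ω ∩ A i).encard) P := fun i =>
      hY.aemeasurable_count _ (hA i)
    have hnm : ∀ i, AEMeasurable (fun ω => (Y ω ∩ A i).ncard) P := fun i =>
      (measurable_from_top (f := ENat.toNat)).comp_aemeasurable (hcm i)
    have hfinae := eventually_countable_forall.mpr
      fun i => IsCorrelationFunction.ae_finite hY (h 1) (hA i) (hfin i)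
    have hprob : ∀ i, IsProbabilityMeasure
        ((poissonMeasure (volume (A i)).toNNReal).map (Nat.cast : ℕ → ℕ∞)) := fun i =>
      inferInstance
    -- The space of count vectors is countable, so point masses determine the law. Vectors with an
    -- infinite entry have mass zero on both sides.
    refine Measure.ext_of_singleton fun x => ?_
    rw [Measure.map_apply_of_aemeasurable (aemeasurable_pi_lambda _ hcm) (measurableSet_singleton _),
      Measure.pi_singleton]
    have hmap : ∀ i, ((poissonMeasure (volume (A i)).toNNReal).map (Nat.cast : ℕ → ℕ∞)) {x i} =
        poissonMeasure (volume (A i)).toNNReal ((Nat.cast : ℕ → ℕ∞) ⁻¹' {x i}) := fun i =>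
      Measure.map_apply measurable_from_top (measurableSet_singleton _)
    simp only [hmap]
    by_cases hx : ∃ i, x i = ⊤
    · obtain ⟨i, hi⟩ := hx
      rw [Finset.prod_eq_zero (Finset.mem_univ i)]
      · refine measure_mono_null (t := {ω | ¬ ∀ i, (Y ω ∩ A i).Finite}) ?_ (ae_iff.mp hfinae)
        intro ω hω hall
        have h1 : (Y ω ∩ A i).encard = x i := congrFun hω i
        rw [hi] at h1
        exact Set.encard_ne_top_iff.mpr (hall i) h1
      · have : (Nat.cast : ℕ → ℕ∞) ⁻¹' {x i} = ∅ := by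
          ext n; simp [hi]
        rw [this, measure_empty]
    · push Not at hx
      have hxk : ∀ i, x i = ((x i).toNat : ℕ∞) := fun i => (ENat.natCast_toNat (hx i)).symm
      have hpre : ∀ i, (Nat.cast : ℕ → ℕ∞) ⁻¹' {x i} = {(x i).toNat} := by
        intro i
        ext n
        rw [Set.mem_preimage, Set.mem_singleton_iff, Set.mem_singleton_iff, hxk i]
        simp
      simp only [hpre, poissonMeasure_singleton]
      have hmain := measure_eq_of_choose hnm (fun i => ENNReal.toReal_nonneg)
        (IsCorrelationFunction.lintegral_prod_choose hY h hA hfin hdisj) fun i => (x i).toNat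
      rw [ENNReal.ofReal_prod_of_nonneg (fun i _ => by positivity)] at hmain
      refine Eq.trans (measure_congr ?_) hmain
      filter_upwards [hfinae] with ω hω
      refine propext ?_
      change (fun i => (Y ω ∩ A i).encard) = x ↔ ∀ i, (Y ω ∩ A i).ncard = (x i).toNat
      rw [funext_iff]
      refine forall_congr' fun i => ?_
      rw [hxk i, ← (hω i).cast_ncard_eq]
      simp
  have hlaw : ∀ (m : ℕ) (A : Fin m → Set ℝ), (∀ i, MeasurableSet (A i)) →
      (∀ i, volume (A i) ≠ ∞) → Pairwise (fun i j => Disjoint (A i) (A j)) → ∀ i,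
      P.map (fun ω => (Y ω ∩ A i).encard) =
        (poissonMeasure (volume (A i)).toNNReal).map (Nat.cast : ℕ → ℕ∞) := by
    intro m A hA hfin hdisj i
    have hprob : ∀ i, IsProbabilityMeasure
        ((poissonMeasure (volume (A i)).toNNReal).map (Nat.cast : ℕ → ℕ∞)) := fun i =>
      inferInstance
    have h1 := (measurePreserving_eval (fun i =>
      (poissonMeasure (volume (A i)).toNNReal).map (Nat.cast : ℕ → ℕ∞)) i).map_eq
    rw [← hjoint m A hA hfin hdisj, AEMeasurable.map_map_of_aemeasurable
      (measurable_pi_apply i).aemeasurable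
      (aemeasurable_pi_lambda _ fun i => hY.aemeasurable_count _ (hA i))] at h1
    exact h1
  refine ⟨hY, fun m A hA hfin hdisj => ?_, fun A hA hfin => ⟨hY.aemeasurable_count _ hA, ?_⟩⟩
  · rw [iIndepFun_iff_map_fun_eq_pi_map fun i => hY.aemeasurable_count _ (hA i),
      hjoint m A hA hfin hdisj]
    congr 1
    ext1 i
    exact (hlaw m A hA hfin hdisj i).symm
  · exact hlaw 1 (fun _ => A) (fun _ => hA) (fun _ => hfin)
      (fun i j hij => absurd (Subsingleton.elim i j) hij) 0

end PoissonCharacterization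

/-! ### The distribution `Beta(1, t)` -/

section Beta

variable {t : ℝ}

lemma one_div_beta_one (ht : 0 < t) : 1 / beta 1 t = t := by
  rw [beta, Real.Gamma_one, one_mul, add_comm, Real.Gamma_add_one ht.ne']
  have := (Real.Gamma_pos_of_pos ht).ne'
  field_simp

lemma lintegral_betaMeasure_one (ht : 0 < t) (f : ℝ → ℝ≥0∞) :
    ∫⁻ u, f u ∂(betaMeasure 1 t) =
      ∫⁻ u in Set.Ioo 0 1, ENNReal.ofReal (t * (1 - u) ^ (t - 1)) * f u := by
  have hm : Measurable (betaPDF 1 t) := (measurable_betaPDFReal 1 t).ennreal_ofReal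
  rw [betaMeasure, lintegral_withDensity_eq_lintegral_mul_non_measurable _ hm
    (Eventually.of_forall fun x => ENNReal.ofReal_lt_top), ← lintegral_indicator measurableSet_Ioo]
  refine lintegral_congr fun u => ?_
  by_cases hu : u ∈ Set.Ioo (0 : ℝ) 1
  · rw [Set.indicator_of_mem hu, Pi.mul_apply, betaPDF_of_pos_lt_one hu.1 hu.2, one_div_beta_one ht]
    simp
  · rw [Set.indicator_of_notMem hu, Pi.mul_apply, betaPDF_eq,
      if_neg (show ¬ (0 < u ∧ u < 1) from hu)]
    simp

lemma lintegral_rpow_sub {s b : ℝ} (hs : 0 < s) (hb : 0 ≤ b) :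
    ∫⁻ u in Set.Ioo 0 b, ENNReal.ofReal (s * (b - u) ^ (s - 1)) = ENNReal.ofReal (b ^ s) := by
  have hint : IntervalIntegrable (fun u : ℝ => s * (b - u) ^ (s - 1)) volume 0 b := by
    have h1 := (intervalIntegral.intervalIntegrable_rpow' (a := b) (b := 0)
      (by linarith : -1 < s - 1)).comp_sub_left b
    simp only [sub_self, sub_zero] at h1
    exact h1.const_mul s
  rw [setLIntegral_congr Ioo_ae_eq_Ioc]
  rw [← ofReal_integral_eq_lintegral_ofReal, ← intervalIntegral.integral_of_le hb,
    intervalIntegral.integral_const_mul,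
    intervalIntegral.integral_comp_sub_left (fun x : ℝ => x ^ (s - 1)), integral_rpow]
  · rw [sub_self, sub_zero, sub_add_cancel, Real.zero_rpow hs.ne', sub_zero, mul_div_cancel₀ _ hs.ne']
  · left; linarith
  · exact (intervalIntegrable_iff_integrableOn_Ioc_of_le hb).mp hint
  · filter_upwards [ae_restrict_mem measurableSet_Ioc] with u hu
    have : 0 ≤ b - u := sub_nonneg.mpr hu.2
    positivity

/-- For $n\ge1$ this is the contraction factor of the stick-breaking recursion. -/
lemma lintegral_one_sub_pow_betaMeasure (ht : 0 < t) (n : ℕ) :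
    ∫⁻ u, ENNReal.ofReal (1 - u) ^ n ∂(betaMeasure 1 t) = ENNReal.ofReal (t / (t + n)) := by
  have hs : 0 < t + n := by positivity
  rw [lintegral_betaMeasure_one ht]
  have h1 : ∀ u ∈ Set.Ioo (0 : ℝ) 1, ENNReal.ofReal (t * (1 - u) ^ (t - 1)) *
      ENNReal.ofReal (1 - u) ^ n =
      ENNReal.ofReal (t / (t + n)) * ENNReal.ofReal ((t + n) * (1 - u) ^ (t + n - 1)) := by
    intro u hu
    have hu1 : 0 < 1 - u := sub_pos.mpr hu.2
    rw [← ENNReal.ofReal_pow hu1.le, ← ENNReal.ofReal_mul (by positivity),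
      ← ENNReal.ofReal_mul (by positivity)]
    congr 1
    rw [show t + n - 1 = (t - 1) + n by ring, Real.rpow_add_natCast hu1.ne']
    field_simp
  rw [setLIntegral_congr_fun measurableSet_Ioo h1, lintegral_const_mul' _ _ ENNReal.ofReal_ne_top,
    lintegral_rpow_sub hs zero_le_one, Real.one_rpow, ENNReal.ofReal_one, mul_one]

lemma ae_mem_Ioo_betaMeasure (ht : 0 < t) : ∀ᵐ u ∂(betaMeasure 1 t), u ∈ Set.Ioo (0 : ℝ) 1 := by
  change betaMeasure 1 t (Set.Ioo (0 : ℝ) 1)ᶜ = 0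
  rw [← lintegral_indicator_one (measurableSet_Ioo.compl : MeasurableSet (Set.Ioo (0 : ℝ) 1)ᶜ),
    lintegral_betaMeasure_one ht, setLIntegral_eq_zero measurableSet_Ioo]
  intro u hu
  simp [hu.1, hu.2]

lemma betaMeasure_singleton (t x : ℝ) : betaMeasure 1 t {x} = 0 := by
  rw [betaMeasure]
  exact withDensity_absolutelyContinuous _ _ (measure_singleton x)

end Beta

/-! ### The stick-breaking sequence and removal of its first stick -/

section Shift

/-- The sequence `a, u 0, u 1, …`. -/
def seqCons (a : ℝ) (u : ℕ → ℝ) : ℕ → ℝ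
  | 0 => a
  | k + 1 => u k

lemma measurable_seqCons : Measurable fun p : ℝ × (ℕ → ℝ) => seqCons p.1 p.2 := by
  refine measurable_pi_lambda _ fun k => ?_
  cases k with
  | zero => exact measurable_fst
  | succ k => exact (measurable_pi_apply k).comp measurable_snd

/-- A sequence of independent identically distributed variables is obtained by prepending an
independent variable with the same distribution. -/
lemma measurePreserving_seqCons (μ : Measure ℝ) [IsProbabilityMeasure μ] :
    MeasurePreserving (fun p : ℝ × (ℕ → ℝ) => seqCons p.1 p.2)
      (μ.prod (Measure.infinitePi fun _ : ℕ => μ)) (Measure.infinitePi fun _ : ℕ => μ) := by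
  classical
  refine ⟨measurable_seqCons, Measure.eq_infinitePi _ fun s T hT => ?_⟩
  -- The cylinder over `s` is padded by `Set.univ` to an initial segment of coordinates, from which
  -- coordinate 0 can be split off.
  let T' : ℕ → Set ℝ := fun i => if i ∈ s then T i else Set.univ
  have hT' : ∀ i, MeasurableSet (T' i) := by
    intro i
    by_cases hi : i ∈ s
    · simpa [T', hi] using hT i
    · simp [T', hi]
  have hsub : s ⊆ Finset.range (s.sup id + 1) := fun i hi =>
    Finset.mem_range.mpr (Nat.lt_succ_of_le (Finset.le_sup (f := id) hi))
  have hpi : Set.pi s T = Set.pi (Finset.range (s.sup id + 1)) T' := by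
    ext x
    simp only [Set.mem_pi, Finset.mem_coe]
    constructor
    · intro h i _
      by_cases hi : i ∈ s
      · simpa [T', hi] using h i hi
      · simp [T', hi]
    · intro h i hi
      simpa [T', hi] using h i (hsub hi)
  have hprod : ∏ i ∈ s, μ (T i) = ∏ i ∈ Finset.range (s.sup id + 1), μ (T' i) := by
    rw [← Finset.prod_subset hsub]
    · exact Finset.prod_congr rfl fun i hi => by simp [T', hi]
    · intro i _ hi; simp [T', hi]
  rw [hpi, hprod, Measure.map_apply measurable_seqCons
    (MeasurableSet.pi (Finset.countable_toSet _) fun i _ => hT' i)]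
  have hpre : (fun p : ℝ × (ℕ → ℝ) => seqCons p.1 p.2) ⁻¹'
      Set.pi (Finset.range (s.sup id + 1)) T' =
      T' 0 ×ˢ Set.pi (Finset.range (s.sup id)) fun i => T' (i + 1) := by
    ext ⟨a, u⟩
    simp only [Set.mem_preimage, Set.mem_pi, Finset.mem_coe, Finset.mem_range, Set.mem_prod]
    constructor
    · exact fun h => ⟨h 0 (Nat.succ_pos _), fun i hi => h (i + 1) (Nat.succ_lt_succ hi)⟩
    · rintro ⟨h0, h⟩ i hi
      cases i with
      | zero => exact h0
      | succ i => exact h i (Nat.lt_of_succ_lt_succ hi)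
  rw [hpre, Measure.prod_prod, Measure.infinitePi_pi _ fun i _ => hT' (i + 1),
    Finset.prod_range_succ', mul_comm]

lemma stickBreaking_seqCons_zero (a : ℝ) (u : ℕ → ℝ) : stickBreaking (seqCons a u) 0 = a := by
  simp [stickBreaking, seqCons]

lemma stickBreaking_seqCons_succ (a : ℝ) (u : ℕ → ℝ) (k : ℕ) :
    stickBreaking (seqCons a u) (k + 1) = (1 - a) * stickBreaking u k := by
  simp only [stickBreaking, Finset.prod_range_succ']
  simp only [seqCons]
  ring

@[fun_prop]
lemma measurable_stickBreaking (k : ℕ) : Measurable fun u => stickBreaking u k := by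
  unfold stickBreaking; fun_prop

lemma sum_stickBreaking (u : ℕ → ℝ) (K : ℕ) :
    ∑ k ∈ Finset.range K, stickBreaking u k = 1 - ∏ i ∈ Finset.range K, (1 - u i) := by
  induction K with
  | zero => simp
  | succ K ih =>
    rw [Finset.sum_range_succ, ih, Finset.prod_range_succ, stickBreaking]
    ring

lemma stickBreaking_mem_Ioo {u : ℕ → ℝ} (hu : ∀ k, u k ∈ Set.Ioo (0 : ℝ) 1) (k : ℕ) :
    stickBreaking u k ∈ Set.Ioo (0 : ℝ) 1 := by
  have h1 : ∀ i, 0 < 1 - u i := fun i => sub_pos.mpr (hu i).2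
  have h2 : 0 < ∏ i ∈ Finset.range k, (1 - u i) := Finset.prod_pos fun i _ => h1 i
  have h3 : ∏ i ∈ Finset.range k, (1 - u i) ≤ 1 :=
    Finset.prod_le_one (fun i _ => (h1 i).le) fun i _ => by linarith [(hu i).1]
  refine ⟨mul_pos (hu k).1 h2, ?_⟩
  calc u k * ∏ i ∈ Finset.range k, (1 - u i) ≤ u k * 1 := by gcongr; exact (hu k).1.le
    _ < 1 := by rw [mul_one]; exact (hu k).2

lemma tsum_stickBreaking_le_one {u : ℕ → ℝ} (hu : ∀ k, u k ∈ Set.Ioo (0 : ℝ) 1) :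
    ∑' k, ENNReal.ofReal (stickBreaking u k) ≤ 1 := by
  rw [ENNReal.tsum_eq_iSup_nat]
  refine iSup_le fun K => ?_
  rw [← ENNReal.ofReal_sum_of_nonneg fun k _ => (stickBreaking_mem_Ioo hu k).1.le,
    sum_stickBreaking, ENNReal.ofReal_le_one]
  have : 0 ≤ ∏ i ∈ Finset.range K, (1 - u i) :=
    Finset.prod_nonneg fun i _ => sub_nonneg.mpr (hu i).2.le
  linarith

variable {t : ℝ}

lemma isProbabilityMeasure_iidBeta (ht : 0 < t) : IsProbabilityMeasure (iidBeta t) := by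
  have := isProbabilityMeasureBeta one_pos ht
  unfold iidBeta; infer_instance

lemma ae_iidBeta_mem_Ioo (ht : 0 < t) : ∀ᵐ u ∂(iidBeta t), ∀ k, u k ∈ Set.Ioo (0 : ℝ) 1 := by
  have := isProbabilityMeasureBeta one_pos ht
  rw [ae_all_iff]
  intro k
  exact (measurePreserving_eval_infinitePi (fun _ : ℕ => betaMeasure 1 t) k).quasiMeasurePreserving.ae
    (ae_mem_Ioo_betaMeasure ht)

lemma lintegral_iidBeta (ht : 0 < t) {F : (ℕ → ℝ) → ℝ≥0∞} (hF : Measurable F) :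
    ∫⁻ u, F u ∂(iidBeta t) = ∫⁻ a, ∫⁻ u, F (seqCons a u) ∂(iidBeta t) ∂(betaMeasure 1 t) := by
  have := isProbabilityMeasureBeta one_pos ht
  have := isProbabilityMeasure_iidBeta ht
  have h := measurePreserving_seqCons (betaMeasure 1 t)
  change MeasurePreserving _ ((betaMeasure 1 t).prod (iidBeta t)) (iidBeta t) at h
  rw [← h.lintegral_comp hF]
  exact lintegral_prod _ (hF.comp measurable_seqCons).aemeasurable

/-- Removing the first stick reduces `j` to 0. There, given the later variables, equality forces the
first one to be $v/(1+v)$, and the beta law has no atoms. -/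
lemma ae_stickBreaking_ne (ht : 0 < t) (j : ℕ) :
    ∀ k, j < k → ∀ᵐ u ∂(iidBeta t), stickBreaking u j ≠ stickBreaking u k := by
  have := isProbabilityMeasureBeta one_pos ht
  have hP := isProbabilityMeasure_iidBeta ht
  have hmp := measurePreserving_seqCons (betaMeasure 1 t)
  change MeasurePreserving _ ((betaMeasure 1 t).prod (iidBeta t)) (iidBeta t) at hmp
  have hms : ∀ j k, MeasurableSet {u : ℕ → ℝ | stickBreaking u j ≠ stickBreaking u k} := fun j k =>
    (measurableSet_eq_fun (measurable_stickBreaking j) (measurable_stickBreaking k)).compl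
  induction j with
  | zero =>
    intro k hk
    obtain ⟨k, rfl⟩ := Nat.exists_eq_succ_of_ne_zero hk.ne'
    rw [← hmp.map_eq, ae_map_iff measurable_seqCons.aemeasurable (hms _ _)]
    simp only [Nat.succ_eq_add_one, stickBreaking_seqCons_zero, stickBreaking_seqCons_succ]
    have hset : MeasurableSet {p : ℝ × (ℕ → ℝ) | p.1 = (1 - p.1) * stickBreaking p.2 k} :=
      measurableSet_eq_fun measurable_fst (by fun_prop)
    have h0 : {p : ℝ × (ℕ → ℝ) | ¬ p.1 ≠ (1 - p.1) * stickBreaking p.2 k} =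
        {p : ℝ × (ℕ → ℝ) | p.1 = (1 - p.1) * stickBreaking p.2 k} := by
      ext p; simp
    rw [ae_iff, h0, Measure.prod_apply_symm hset, lintegral_eq_zero_iff
      (measurable_measure_prodMk_right hset)]
    filter_upwards [ae_iidBeta_mem_Ioo ht] with u hu
    have hv := (stickBreaking_mem_Ioo hu k).1
    refine measure_mono_null (t := {stickBreaking u k / (1 + stickBreaking u k)}) ?_
      (betaMeasure_singleton t _)
    intro a ha
    simp only [Set.mem_preimage, Set.mem_ofPred_eq] at ha
    rw [Set.mem_singleton_iff, eq_div_iff (by positivity)]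
    linarith
  | succ j ih =>
    intro k hk
    obtain ⟨k, rfl⟩ := Nat.exists_eq_succ_of_ne_zero (Nat.ne_zero_of_lt hk)
    rw [← hmp.map_eq, ae_map_iff measurable_seqCons.aemeasurable (hms _ _)]
    simp only [Nat.succ_eq_add_one, stickBreaking_seqCons_succ]
    filter_upwards [Measure.quasiMeasurePreserving_fst.ae (ae_mem_Ioo_betaMeasure ht),
      Measure.quasiMeasurePreserving_snd.ae (ih k (Nat.lt_of_succ_lt_succ hk))] with p h1 h2 h3
    exact h2 (mul_left_cancel₀ (sub_pos.mpr h1.2).ne' h3)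

lemma ae_injective_stickBreaking (ht : 0 < t) :
    ∀ᵐ u ∂(iidBeta t), Function.Injective (stickBreaking u) := by
  have : ∀ᵐ u ∂(iidBeta t), ∀ j k, j < k → stickBreaking u j ≠ stickBreaking u k := by
    simp only [ae_all_iff]
    exact ae_stickBreaking_ne ht
  filter_upwards [this] with u hu j k hjk
  rcases lt_trichotomy j k with h | h | h
  · exact absurd hjk (hu j k h)
  · exact h
  · exact absurd hjk.symm (hu k j h)

end Shift

/-! ### The candidate correlation functions and their recursion -/

section PoissonDirichletDensity

lemma measurableSet_simplex (n : ℕ) :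
    MeasurableSet {x : Fin n → ℝ | (∀ i, 0 < x i) ∧ ∑ i, x i < 1} := by
  have h1 : ∀ i, MeasurableSet {x : Fin n → ℝ | 0 < x i} := fun i =>
    measurableSet_lt measurable_const (measurable_pi_apply i)
  have h2 : MeasurableSet {x : Fin n → ℝ | ∑ i, x i < 1} :=
    measurableSet_lt (by fun_prop) measurable_const
  convert (MeasurableSet.iInter h1).inter h2 using 1
  ext x
  simp

/-- The correlation functions of the Poisson–Dirichlet process. -/
noncomputable def pdCorrelation (t : ℝ) (n : ℕ) (x : Fin n → ℝ) : ℝ :=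
  if (∀ i, 0 < x i) ∧ ∑ i, x i < 1 then t ^ n * (1 - ∑ i, x i) ^ (t - 1) / ∏ i, x i else 0

/-- The joint density of a `Beta(1, t)` variable `u` and of `n` points of the process shrunk by
`1 - u`. -/
noncomputable def pdJointDensity (t : ℝ) (n : ℕ) (u : ℝ) (y : Fin n → ℝ) : ℝ :=
  if (∀ i, 0 < y i) ∧ ∑ i, y i < 1 - u then
    t ^ (n + 1) * (1 - u - ∑ i, y i) ^ (t - 1) / ∏ i, y i else 0

variable {t : ℝ} {n : ℕ}

@[fun_prop]
lemma measurable_pdCorrelation : Measurable (pdCorrelation t n) := by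
  classical
  have hs := measurableSet_simplex n
  exact Measurable.ite hs (by fun_prop) measurable_const

lemma measurable_pdJointDensity :
    Measurable fun p : ℝ × (Fin n → ℝ) => pdJointDensity t n p.1 p.2 := by
  classical
  have h1 : ∀ i, MeasurableSet {p : ℝ × (Fin n → ℝ) | 0 < p.2 i} := fun i =>
    measurableSet_lt measurable_const (by fun_prop)
  have h2 : MeasurableSet {p : ℝ × (Fin n → ℝ) | ∑ i, p.2 i < 1 - p.1} :=
    measurableSet_lt (by fun_prop) (by fun_prop)
  have hs : MeasurableSet {p : ℝ × (Fin n → ℝ) | (∀ i, 0 < p.2 i) ∧ ∑ i, p.2 i < 1 - p.1} := by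
    convert (MeasurableSet.iInter h1).inter h2 using 1
    ext p
    simp
  exact Measurable.ite hs (by fun_prop) measurable_const

lemma pdCorrelation_nonneg (ht : 0 < t) (x : Fin n → ℝ) : 0 ≤ pdCorrelation t n x := by
  rw [pdCorrelation]
  split_ifs with h
  · have h1 : 0 ≤ 1 - ∑ i, x i := by linarith [h.2]
    have h2 : 0 ≤ ∏ i, x i := Finset.prod_nonneg fun i _ => (h.1 i).le
    positivity
  · exact le_rfl

/-- The value of the linear statistic `∏ g i (x i)` on the correlation function. -/
noncomputable def pdIntegral (t : ℝ) (n : ℕ) (g : Fin n → ℝ → ℝ≥0∞) : ℝ≥0∞ :=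
  ∫⁻ x, (∏ i, g i (x i)) * ENNReal.ofReal (pdCorrelation t n x)

lemma lintegral_smul_mul_pdCorrelation {c : ℝ} (hc : 0 < c) (H : (Fin n → ℝ) → ℝ≥0∞) :
    ∫⁻ x, H (c • x) * ENNReal.ofReal (pdCorrelation t n x) =
      ∫⁻ y, H y * ENNReal.ofReal ((c ^ n)⁻¹ * pdCorrelation t n (c⁻¹ • y)) := by
  let F : (Fin n → ℝ) → ℝ≥0∞ := fun y => H y * ENNReal.ofReal (pdCorrelation t n (c⁻¹ • y))
  have h1 : ∀ x, H (c • x) * ENNReal.ofReal (pdCorrelation t n x) =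
      F (MeasurableEquiv.smul₀ c hc.ne' x) := by
    intro x
    simp only [F, MeasurableEquiv.coe_smul₀, inv_smul_smul₀ hc.ne']
  simp only [h1]
  rw [← lintegral_map_equiv, MeasurableEquiv.coe_smul₀, Measure.map_addHaar_smul _ hc.ne',
    lintegral_smul_measure, Module.finrank_fin_fun, smul_eq_mul, ← lintegral_const_mul' _ _
    ENNReal.ofReal_ne_top]
  refine lintegral_congr fun y => ?_
  have h2 : 0 ≤ (c ^ n)⁻¹ := by positivity
  rw [abs_of_nonneg h2, ENNReal.ofReal_mul h2]
  simp only [F]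
  ring

/-- The Jacobian $(1-u)^{-n}$ cancels against the denominator $\prod y_i/(1-u)$, and the beta
density combines with $(1-\sum y_i/(1-u))^{t-1}$ into $(1-u-\sum y_i)^{t-1}$. -/
lemma mul_pdCorrelation_inv_smul {u : ℝ} (hu : u < 1) (y : Fin n → ℝ) :
    t * (1 - u) ^ (t - 1) * (((1 - u) ^ n)⁻¹ * pdCorrelation t n ((1 - u)⁻¹ • y)) =
      pdJointDensity t n u y := by
  have hc : 0 < 1 - u := sub_pos.mpr hu
  have hsum : ∑ i, ((1 - u)⁻¹ • y) i = (∑ i, y i) / (1 - u) := by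
    simp only [Pi.smul_apply, smul_eq_mul, ← Finset.mul_sum]
    rw [inv_mul_eq_div]
  have hprod : ∏ i, ((1 - u)⁻¹ • y) i = ((1 - u) ^ n)⁻¹ * ∏ i, y i := by
    simp only [Pi.smul_apply, smul_eq_mul, Finset.prod_mul_distrib, Finset.prod_const,
      Finset.card_univ, Fintype.card_fin, inv_pow]
  have hpos : ∀ i, 0 < ((1 - u)⁻¹ • y) i ↔ 0 < y i := fun i => by
    simp only [Pi.smul_apply, smul_eq_mul]
    exact mul_pos_iff_of_pos_left (inv_pos.mpr hc)
  rw [pdCorrelation, pdJointDensity]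
  simp only [hpos, hsum, hprod, div_lt_one hc]
  split_ifs with h
  · have h1 : 0 ≤ 1 - (∑ i, y i) / (1 - u) := by
      rw [sub_nonneg, div_le_one hc]; exact h.2.le
    have h2 : 1 - u - ∑ i, y i = (1 - u) * (1 - (∑ i, y i) / (1 - u)) := by
      field_simp
    have h3 : (∏ i, y i) ≠ 0 := (Finset.prod_pos fun i _ => h.1 i).ne'
    rw [h2, Real.mul_rpow hc.le h1, pow_succ]
    generalize (1 - (∑ i, y i) / (1 - u)) ^ (t - 1) = w
    field_simp
  · simp

/-- Integrating out the stick raises the exponent from $t-1$ to $t$: on the simplex the result is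
$1-\sum y_i$ times the correlation function. -/
lemma lintegral_pdJointDensity (ht : 0 < t) (y : Fin n → ℝ) :
    ∫⁻ u in Set.Ioo 0 1, ENNReal.ofReal (pdJointDensity t n u y) =
      ENNReal.ofReal (if (∀ i, 0 < y i) ∧ ∑ i, y i < 1 then
        t ^ n * (1 - ∑ i, y i) ^ t / ∏ i, y i else 0) := by
  split_ifs with h
  · have hS : 0 ≤ ∑ i, y i := Finset.sum_nonneg fun i _ => (h.1 i).le
    have hP : 0 < ∏ i, y i := Finset.prod_pos fun i _ => h.1 i
    have h1 : ∀ u, ENNReal.ofReal (pdJointDensity t n u y) =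
        (Set.Iio (1 - ∑ i, y i)).indicator (fun u => ENNReal.ofReal (t ^ n / ∏ i, y i) *
          ENNReal.ofReal (t * (1 - ∑ i, y i - u) ^ (t - 1))) u := by
      intro u
      rw [pdJointDensity]
      by_cases hu : u < 1 - ∑ i, y i
      · rw [Set.indicator_of_mem (Set.mem_Iio.mpr hu), if_pos ⟨h.1, by linarith⟩,
          ← ENNReal.ofReal_mul (by positivity)]
        congr 1
        rw [show 1 - ∑ i, y i - u = 1 - u - ∑ i, y i by ring]
        ring
      · rw [Set.indicator_of_notMem (by simpa using hu), if_neg (fun h' => hu (by linarith [h'.2])),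
          ENNReal.ofReal_zero]
    simp only [h1]
    rw [setLIntegral_indicator measurableSet_Iio]
    have h2 : Set.Iio (1 - ∑ i, y i) ∩ Set.Ioo 0 1 = Set.Ioo 0 (1 - ∑ i, y i) := by
      ext u
      simp only [Set.mem_inter_iff, Set.mem_Iio, Set.mem_Ioo]
      exact ⟨fun h => ⟨h.2.1, h.1⟩, fun h => ⟨h.2, h.1, by linarith [h.2]⟩⟩
    rw [h2, lintegral_const_mul' _ _ ENNReal.ofReal_ne_top,
      lintegral_rpow_sub ht (by linarith [h.2]), ← ENNReal.ofReal_mul (by positivity)]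
    congr 1
    ring
  · rw [ENNReal.ofReal_zero]
    refine setLIntegral_eq_zero measurableSet_Ioo fun u hu => ?_
    rw [pdJointDensity, if_neg, ENNReal.ofReal_zero, Pi.zero_apply]
    exact fun h' => h ⟨h'.1, by linarith [h'.2, hu.1]⟩

/-- Rescaling of the test functions. -/
def rescale (c : ℝ) (g : Fin n → ℝ → ℝ≥0∞) : Fin n → ℝ → ℝ≥0∞ := fun i x => g i (c * x)

lemma measurable_pdIntegral_rescale {g : Fin n → ℝ → ℝ≥0∞} (hg : ∀ i, Measurable (g i)) :
    Measurable fun u : ℝ => pdIntegral t n (rescale (1 - u) g) := by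
  unfold pdIntegral rescale
  have h : Measurable fun p : ℝ × (Fin n → ℝ) =>
    (∏ i, g i ((1 - p.1) * p.2 i)) * ENNReal.ofReal (pdCorrelation t n p.2) := by fun_prop
  exact h.lintegral_prod_right

lemma mul_pdIntegral_rescale (ht : 0 < t) {u : ℝ} (hu : u ∈ Set.Ioo (0 : ℝ) 1)
    (g : Fin n → ℝ → ℝ≥0∞) :
    ENNReal.ofReal (t * (1 - u) ^ (t - 1)) * pdIntegral t n (rescale (1 - u) g) =
      ∫⁻ y, (∏ i, g i (y i)) * ENNReal.ofReal (pdJointDensity t n u y) := by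
  have hc : 0 < 1 - u := sub_pos.mpr hu.2
  have h1 := lintegral_smul_mul_pdCorrelation (t := t) hc fun y : Fin n → ℝ => ∏ i, g i (y i)
  simp only [Pi.smul_apply, smul_eq_mul] at h1
  unfold pdIntegral rescale
  rw [h1, ← lintegral_const_mul' _ _ ENNReal.ofReal_ne_top]
  refine lintegral_congr fun y => ?_
  rw [mul_left_comm, ← ENNReal.ofReal_mul (by positivity), mul_pdCorrelation_inv_smul hu.2]

lemma lintegral_pdIntegral_rescale (ht : 0 < t) {g : Fin n → ℝ → ℝ≥0∞}
    (hg : ∀ i, Measurable (g i)) :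
    ∫⁻ u, pdIntegral t n (rescale (1 - u) g) ∂(betaMeasure 1 t) =
      ∫⁻ y : Fin n → ℝ, (∏ i, g i (y i)) * ENNReal.ofReal (if (∀ i, 0 < y i) ∧ ∑ i, y i < 1 then
        t ^ n * (1 - ∑ i, y i) ^ t / ∏ i, y i else 0) := by
  rw [lintegral_betaMeasure_one ht, setLIntegral_congr_fun measurableSet_Ioo
    fun u hu => mul_pdIntegral_rescale ht hu g, lintegral_lintegral_swap]
  · refine lintegral_congr fun y => ?_
    rw [← lintegral_pdJointDensity ht, lintegral_const_mul]
    exact (measurable_pdJointDensity.comp (measurable_id.prodMk measurable_const)).ennreal_ofReal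
  · have := (measurable_pdJointDensity (t := t) (n := n)).ennreal_ofReal
    refine Measurable.aemeasurable ?_
    exact Measurable.mul (by fun_prop) this

/-- The contribution of tuples whose `i`-th point is the first stick. Taking $u$ as the coordinate
$z_i$, the joint density lacks the factor $z_i$ in its denominator, so it is $z_i$ times the
correlation function of order $n+1$. -/
lemma lintegral_mul_pdIntegral_rescale (ht : 0 < t) {g : Fin (n + 1) → ℝ → ℝ≥0∞}
    (hg : ∀ i, Measurable (g i)) (i : Fin (n + 1)) :
    ∫⁻ u, g i u * pdIntegral t n (rescale (1 - u) fun j => g (i.succAbove j)) ∂(betaMeasure 1 t) =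
      ∫⁻ z : Fin (n + 1) → ℝ, (∏ i, g i (z i)) * ENNReal.ofReal (if (∀ i, 0 < z i) ∧ ∑ i, z i < 1 then
        z i * (t ^ (n + 1) * (1 - ∑ i, z i) ^ (t - 1) / ∏ i, z i) else 0) := by
  classical
  rw [lintegral_betaMeasure_one ht]
  have h1 : ∀ u ∈ Set.Ioo (0 : ℝ) 1, ENNReal.ofReal (t * (1 - u) ^ (t - 1)) *
      (g i u * pdIntegral t n (rescale (1 - u) fun j => g (i.succAbove j))) =
      ∫⁻ y, g i u * ((∏ j, g (i.succAbove j) (y j)) *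
        ENNReal.ofReal (pdJointDensity t n u y)) := by
    intro u hu
    rw [mul_left_comm, mul_pdIntegral_rescale ht hu, lintegral_const_mul]
    have := (measurable_pdJointDensity (t := t) (n := n)).comp
      (measurable_const.prodMk measurable_id : Measurable fun y : Fin n → ℝ => (u, y))
    exact Measurable.mul (by fun_prop) this.ennreal_ofReal
  have hmeas : Measurable fun z : Fin (n + 1) → ℝ => (∏ i, g i (z i)) *
      ENNReal.ofReal (if (∀ i, 0 < z i) ∧ ∑ i, z i < 1 then
        z i * (t ^ (n + 1) * (1 - ∑ i, z i) ^ (t - 1) / ∏ i, z i) else 0) := by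
    have hs := measurableSet_simplex (n + 1)
    refine Measurable.mul (by fun_prop) (Measurable.ennreal_ofReal ?_)
    exact Measurable.ite hs (by fun_prop) measurable_const
  rw [setLIntegral_congr_fun measurableSet_Ioo h1, ← lintegral_indicator measurableSet_Ioo,
    ((volume_preserving_piFinSuccAbove (fun _ : Fin (n + 1) => ℝ) i).symm).lintegral_map_equiv,
    Measure.volume_eq_prod, lintegral_prod]
  · refine lintegral_congr fun u => ?_
    by_cases hu : u ∈ Set.Ioo (0 : ℝ) 1
    · rw [Set.indicator_of_mem hu]
      refine lintegral_congr fun y => ?_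
      simp only [MeasurableEquiv.piFinSuccAbove_symm_apply, Fin.insertNthEquiv_apply,
        Fin.prod_univ_succAbove _ i, Fin.sum_univ_succAbove _ i, Fin.forall_iff_succAbove i,
        Fin.insertNth_apply_same, Fin.insertNth_apply_succAbove]
      rw [mul_assoc, pdJointDensity]
      congr 3
      -- The simplex already forces $0<u<1$, so restricting the outer integral loses nothing.
      have h2 : ((∀ j, 0 < y j) ∧ ∑ j, y j < 1 - u) ↔
          ((0 < u ∧ ∀ j, 0 < y j) ∧ u + ∑ j, y j < 1) :=
        ⟨fun h => ⟨⟨hu.1, h.1⟩, by linarith [h.2]⟩, fun h => ⟨h.1.2, by linarith [h.2]⟩⟩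
      by_cases h : (∀ j, 0 < y j) ∧ ∑ j, y j < 1 - u
      · rw [if_pos h, if_pos (h2.mp h), sub_sub]
        have := hu.1.ne'
        field_simp
      · rw [if_neg h, if_neg (fun h' => h (h2.mpr h'))]
    · rw [Set.indicator_of_notMem hu]
      symm
      rw [lintegral_eq_zero_of_ae_eq_zero]
      refine Eventually.of_forall fun y => ?_
      simp only [MeasurableEquiv.piFinSuccAbove_symm_apply, Fin.insertNthEquiv_apply,
        Fin.prod_univ_succAbove _ i, Fin.sum_univ_succAbove _ i, Fin.forall_iff_succAbove i,
        Fin.insertNth_apply_same, Fin.insertNth_apply_succAbove]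
      rw [if_neg, ENNReal.ofReal_zero, mul_zero, Pi.zero_apply]
      rintro ⟨⟨h0, hy⟩, hlt⟩
      have : 0 ≤ ∑ j, y j := Finset.sum_nonneg fun j _ => (hy j).le
      exact hu ⟨h0, by linarith⟩
  · exact (hmeas.comp (MeasurableEquiv.measurable _)).aemeasurable

/-- The self-similarity of the correlation functions: removing the first stick. -/
theorem pdIntegral_succ (ht : 0 < t) {g : Fin (n + 1) → ℝ → ℝ≥0∞} (hg : ∀ i, Measurable (g i)) :
    pdIntegral t (n + 1) g = ∫⁻ u, (pdIntegral t (n + 1) (rescale (1 - u) g) +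
      ∑ i, g i u * pdIntegral t n (rescale (1 - u) fun j => g (i.succAbove j)))
        ∂(betaMeasure 1 t) := by
  classical
  have hs := measurableSet_simplex (n + 1)
  rw [lintegral_add_left (measurable_pdIntegral_rescale hg), lintegral_finsetSum,
    lintegral_pdIntegral_rescale ht hg]
  swap
  · exact fun i _ => (hg i).mul (measurable_pdIntegral_rescale fun j => hg _)
  simp only [lintegral_mul_pdIntegral_rescale ht hg]
  rw [← lintegral_finsetSum, ← lintegral_add_left]
  · refine lintegral_congr fun z => ?_
    rw [← Finset.mul_sum, ← mul_add, pdCorrelation]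
    congr 1
    by_cases h : (∀ i, 0 < z i) ∧ ∑ i, z i < 1
    · have hS : 0 < 1 - ∑ i, z i := by linarith [h.2]
      have hP : 0 < ∏ i, z i := Finset.prod_pos fun i _ => h.1 i
      simp only [if_pos h]
      rw [← ENNReal.ofReal_sum_of_nonneg, ← ENNReal.ofReal_add, ← Finset.sum_mul]
      · congr 1
        -- Factoring out $(1-S)^{t-1}$ leaves $(1-S)+\sum z_i=1$, the source of the recursion.
        have h1 : (1 - ∑ i, z i) ^ t = (1 - ∑ i, z i) ^ (t - 1) * (1 - ∑ i, z i) := by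
          rw [← Real.rpow_add_one hS.ne', sub_add_cancel]
        rw [h1]
        ring
      · positivity
      · refine Finset.sum_nonneg fun i _ => ?_
        have := (h.1 i).le
        positivity
      · intro i _
        have := (h.1 i).le
        positivity
    · simp only [if_neg h]
      simp
  · refine Measurable.mul (by fun_prop) (Measurable.ennreal_ofReal ?_)
    exact Measurable.ite hs (by fun_prop) measurable_const
  · intro i _
    refine Measurable.mul (by fun_prop) (Measurable.ennreal_ofReal ?_)
    exact Measurable.ite hs (by fun_prop) measurable_const

end PoissonDirichletDensity

/-! ### Moments of the stick-breaking sequence -/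

section StickMoment

variable {t : ℝ} {n : ℕ}

/-- The sum of `g` over the points of the stick-breaking sequence. -/
noncomputable def stickSum (u : ℕ → ℝ) (g : ℝ → ℝ≥0∞) : ℝ≥0∞ := ∑' k, g (stickBreaking u k)

/-- The expectation of a product of linear statistics of the stick-breaking sequence. -/
noncomputable def stickMoment (t : ℝ) (n : ℕ) (g : Fin n → ℝ → ℝ≥0∞) : ℝ≥0∞ :=
  ∫⁻ u, ∏ i, stickSum u (g i) ∂(iidBeta t)

lemma measurable_stickSum {g : ℝ → ℝ≥0∞} (hg : Measurable g) :
    Measurable fun u => stickSum u g := by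
  unfold stickSum
  exact Measurable.tsum fun k => hg.comp (measurable_stickBreaking k)

lemma stickSum_seqCons (a : ℝ) (u : ℕ → ℝ) (g : ℝ → ℝ≥0∞) :
    stickSum (seqCons a u) g = g a + stickSum u fun x => g ((1 - a) * x) := by
  rw [stickSum, tsum_eq_zero_add' ENNReal.summable, stickBreaking_seqCons_zero]
  simp only [stickBreaking_seqCons_succ]
  rfl

/-- In the expanded product, all terms with two or more factors from `a` vanish. -/
lemma Finset.prod_add_of_mul_eq_zero {ι R : Type*} [CommSemiring R] [DecidableEq ι] (s : Finset ι)
    (a b : ι → R) (hab : ∀ i ∈ s, ∀ j ∈ s, i ≠ j → a i * a j = 0) :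
    ∏ i ∈ s, (a i + b i) = ∏ i ∈ s, b i + ∑ i ∈ s, a i * ∏ j ∈ s.erase i, b j := by
  induction s using Finset.induction_on with
  | empty => simp
  | insert i₀ s hi₀ ih =>
    rw [Finset.prod_insert hi₀, Finset.prod_insert hi₀, Finset.sum_insert hi₀,
      Finset.erase_insert hi₀, ih fun i hi j hj => hab i (Finset.mem_insert_of_mem hi) j
        (Finset.mem_insert_of_mem hj)]
    have h1 : ∑ i ∈ s, a i * ∏ j ∈ (insert i₀ s).erase i, b j =
        b i₀ * ∑ i ∈ s, a i * ∏ j ∈ s.erase i, b j := by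
      rw [Finset.mul_sum]
      refine Finset.sum_congr rfl fun i hi => ?_
      have hne : i₀ ≠ i := fun h => hi₀ (h ▸ hi)
      rw [Finset.erase_insert_of_ne hne, Finset.prod_insert fun h => hi₀ (Finset.mem_of_mem_erase h)]
      ring
    have h2 : a i₀ * ∑ i ∈ s, a i * ∏ j ∈ s.erase i, b j = 0 := by
      rw [Finset.mul_sum]
      refine Finset.sum_eq_zero fun i hi => ?_
      have hne : i₀ ≠ i := fun h => hi₀ (h ▸ hi)
      rw [← mul_assoc, hab i₀ (Finset.mem_insert_self _ _) i (Finset.mem_insert_of_mem hi) hne,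
        zero_mul]
    rw [h1, add_mul, mul_add, h2, add_zero, mul_add]
    ring

lemma Fin.prod_add_of_mul_eq_zero {R : Type*} [CommSemiring R] (a b : Fin (n + 1) → R)
    (hab : ∀ i j, i ≠ j → a i * a j = 0) :
    ∏ i, (a i + b i) = ∏ i, b i + ∑ i, a i * ∏ j, b (i.succAbove j) := by
  rw [Finset.prod_add_of_mul_eq_zero _ a b fun i _ j _ => hab i j]
  congr 1
  refine Finset.sum_congr rfl fun i _ => ?_
  congr 1
  have h1 : Finset.univ.erase i = Finset.univ.image i.succAbove := by
    rw [Fin.image_succAbove_univ]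
    ext j; simp
  rw [h1, Finset.prod_image fun j _ k _ h => Fin.succAbove_right_injective h]

/-- The self-similarity of the stick-breaking sequence: removing the first stick. -/
theorem stickMoment_succ (ht : 0 < t) {g : Fin (n + 1) → ℝ → ℝ≥0∞} (hg : ∀ i, Measurable (g i))
    (hdisj : ∀ i j, i ≠ j → ∀ x, g i x * g j x = 0) :
    stickMoment t (n + 1) g = ∫⁻ u, (stickMoment t (n + 1) (rescale (1 - u) g) +
      ∑ i, g i u * stickMoment t n (rescale (1 - u) fun j => g (i.succAbove j)))
        ∂(betaMeasure 1 t) := by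
  have hprod : ∀ (m : ℕ) (h : Fin m → ℝ → ℝ≥0∞), (∀ i, Measurable (h i)) →
      Measurable fun u => ∏ i, stickSum u (h i) := fun m h hh =>
    Finset.measurable_fun_prod _ fun i _ => measurable_stickSum (hh i)
  have hres : ∀ (m : ℕ) (h : Fin m → ℝ → ℝ≥0∞) (c : ℝ), (∀ i, Measurable (h i)) →
      ∀ i, Measurable (rescale c h i) := fun m h c hh i =>
    (hh i).comp (measurable_const_mul c)
  rw [stickMoment, lintegral_iidBeta ht (hprod _ _ hg)]
  refine lintegral_congr fun a => ?_
  simp only [stickSum_seqCons]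
  -- The test functions have disjoint supports, so at most one of them sees the first stick.
  have h1 : ∀ u : ℕ → ℝ, ∏ i, (g i a + stickSum u fun x => g i ((1 - a) * x)) =
      ∏ i, stickSum u (rescale (1 - a) g i) + ∑ i, g i a *
        ∏ j, stickSum u (rescale (1 - a) (fun j => g (i.succAbove j)) j) := fun u =>
    Fin.prod_add_of_mul_eq_zero _ _ fun i j hij => hdisj i j hij a
  simp only [h1]
  rw [lintegral_add_left (hprod _ _ (hres _ _ _ hg)), lintegral_finsetSum]
  · congr 1
    refine Finset.sum_congr rfl fun i _ => ?_
    rw [lintegral_const_mul _ (hprod _ _ (hres _ _ _ fun j => hg _))]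
    rfl
  · exact fun i _ => (hprod _ _ (hres _ _ _ fun j => hg _)).const_mul _

/-- The sticks have total length at most 1, so each linear statistic is at most `c`. -/
lemma stickMoment_le (ht : 0 < t) {g : Fin n → ℝ → ℝ≥0∞} {c : ℝ≥0∞}
    (hc : ∀ i x, g i x ≤ c * ENNReal.ofReal x) : stickMoment t n g ≤ c ^ n := by
  have := isProbabilityMeasure_iidBeta ht
  calc stickMoment t n g ≤ ∫⁻ _, c ^ n ∂(iidBeta t) := by
        refine lintegral_mono_ae ?_
        filter_upwards [ae_iidBeta_mem_Ioo ht] with u hu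
        calc ∏ i, stickSum u (g i) ≤ ∏ _i : Fin n, c := by
              refine Finset.prod_le_prod' fun i _ => ?_
              calc stickSum u (g i) ≤ ∑' k, c * ENNReal.ofReal (stickBreaking u k) :=
                    ENNReal.tsum_le_tsum fun k => hc i _
                _ = c * ∑' k, ENNReal.ofReal (stickBreaking u k) := ENNReal.tsum_mul_left
                _ ≤ c * 1 := by gcongr; exact tsum_stickBreaking_le_one hu
                _ = c := mul_one c
          _ = c ^ n := by simp
    _ = c ^ n := by simp

lemma pdIntegral_mono {g h : Fin n → ℝ → ℝ≥0∞} (hgh : ∀ i x, g i x ≤ h i x) :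
    pdIntegral t n g ≤ pdIntegral t n h :=
  lintegral_mono fun x => mul_le_mul_left (Finset.prod_le_prod' fun i _ => hgh i (x i)) _

lemma pdIntegral_zero (g : Fin 0 → ℝ → ℝ≥0∞) : pdIntegral t 0 g = 1 := by
  simp [pdIntegral, pdCorrelation, volume_pi]

/-- For $t<1$ the factor $(1-S)^{t-1}$ is unbounded, so finiteness is drawn from the recursion. Its
first term carries $(1-S)^t\le1$, with the denominator cancelled by the test functions; the others
reduce to order `n`. -/
lemma pdIntegral_ofReal_ne_top (ht : 0 < t) (n : ℕ) :
    pdIntegral t n (fun _ => ENNReal.ofReal) ≠ ∞ := by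
  have := isProbabilityMeasureBeta one_pos ht
  induction n with
  | zero => rw [pdIntegral_zero]; exact ENNReal.one_ne_top
  | succ n ih =>
    have hg : ∀ i : Fin (n + 1), Measurable ((fun _ => ENNReal.ofReal) i : ℝ → ℝ≥0∞) := fun _ =>
      ENNReal.measurable_ofReal
    have hu : ∀ u ∈ Set.Ioo (0 : ℝ) 1,
        pdIntegral t n (rescale (1 - u) fun _ => ENNReal.ofReal) ≤
          pdIntegral t n fun _ => ENNReal.ofReal := by
      intro u hu
      refine pdIntegral_mono fun i x => ?_
      rw [rescale]
      rcases le_total 0 x with hx | hx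
      · exact ENNReal.ofReal_le_ofReal (mul_le_of_le_one_left hx (by linarith [hu.1]))
      · rw [ENNReal.ofReal_of_nonpos
          (mul_nonpos_of_nonneg_of_nonpos (by linarith [hu.2]) hx)]
        exact zero_le
    rw [pdIntegral_succ ht hg, lintegral_add_left (measurable_pdIntegral_rescale hg)]
    refine ENNReal.add_ne_top.mpr ⟨?_, ?_⟩
    · rw [lintegral_pdIntegral_rescale ht hg]
      refine ne_top_of_le_ne_top (b := ∫⁻ y : Fin (n + 1) → ℝ,
        (Set.univ.pi fun _ => Set.Icc (0 : ℝ) 1).indicator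
          (fun _ => ENNReal.ofReal (t ^ (n + 1))) y) ?_ (lintegral_mono fun y => ?_)
      · rw [lintegral_indicator_const (MeasurableSet.univ_pi fun _ => measurableSet_Icc),
          volume_pi_pi]
        exact ENNReal.mul_ne_top ENNReal.ofReal_ne_top (by simp)
      · beta_reduce
        split_ifs with h
        · have hS : 0 ≤ 1 - ∑ i, y i := by linarith [h.2]
          have hS1 : 1 - ∑ i, y i ≤ 1 := by
            linarith [Finset.sum_nonneg fun i (_ : i ∈ Finset.univ) => (h.1 i).le]
          have hP : 0 < ∏ i, y i := Finset.prod_pos fun i _ => h.1 i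
          have hy : y ∈ Set.univ.pi fun _ => Set.Icc (0 : ℝ) 1 := fun i _ =>
            ⟨(h.1 i).le, (Finset.single_le_sum (fun j _ => (h.1 j).le)
              (Finset.mem_univ i)).trans h.2.le⟩
          rw [Set.indicator_of_mem hy, ← ENNReal.ofReal_prod_of_nonneg fun i _ => (h.1 i).le,
            ← ENNReal.ofReal_mul hP.le, mul_div_cancel₀ _ hP.ne']
          refine ENNReal.ofReal_le_ofReal (mul_le_of_le_one_right (by positivity) ?_)
          exact Real.rpow_le_one hS hS1 ht.le
        · simp
    · refine ne_top_of_le_ne_top (b := ∫⁻ _ : ℝ, ∑ _i : Fin (n + 1),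
        pdIntegral t n (fun _ => ENNReal.ofReal) ∂(betaMeasure 1 t)) ?_ (lintegral_mono_ae ?_)
      · rw [lintegral_const, measure_univ, mul_one]
        exact ENNReal.sum_ne_top.mpr fun _ _ => ih
      · filter_upwards [ae_mem_Ioo_betaMeasure ht] with u hu'
        refine Finset.sum_le_sum fun i _ => ?_
        refine (mul_le_mul' ?_ (hu u hu')).trans_eq (one_mul _)
        exact ENNReal.ofReal_le_one.mpr hu'.2.le

lemma pdIntegral_le {g : Fin n → ℝ → ℝ≥0∞} {c : ℝ≥0∞} (hct : c ≠ ∞)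
    (hc : ∀ i x, g i x ≤ c * ENNReal.ofReal x) :
    pdIntegral t n g ≤ c ^ n * pdIntegral t n (fun _ => ENNReal.ofReal) := by
  refine (pdIntegral_mono hc).trans (le_of_eq ?_)
  unfold pdIntegral
  rw [← lintegral_const_mul' _ _ (ENNReal.pow_ne_top hct)]
  refine lintegral_congr fun x => ?_
  rw [Finset.prod_mul_distrib, Finset.prod_const, Finset.card_univ, Fintype.card_fin, mul_assoc]

/-- The moments of the stick-breaking sequence are given by the Poisson–Dirichlet correlation
functions. -/
theorem stickMoment_eq_pdIntegral (ht : 0 < t) (n : ℕ) :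
    ∀ (g : Fin n → ℝ → ℝ≥0∞) (c : ℝ≥0∞), (∀ i, Measurable (g i)) →
      (∀ i j, i ≠ j → ∀ x, g i x * g j x = 0) → c ≠ ∞ →
      (∀ i x, g i x ≤ c * ENNReal.ofReal x) → stickMoment t n g = pdIntegral t n g := by
  have := isProbabilityMeasureBeta one_pos ht
  have := isProbabilityMeasure_iidBeta ht
  induction n with
  | zero => intro g c _ _ _ _; rw [pdIntegral_zero]; simp [stickMoment]
  | succ n ih =>
    -- `C * c ^ (n + 1)` dominates both quantities, which starts the iteration.
    set C : ℝ≥0∞ := 1 + pdIntegral t (n + 1) (fun _ => ENNReal.ofReal) with hC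
    have hCt : C ≠ ∞ := ENNReal.add_ne_top.mpr ⟨ENNReal.one_ne_top, pdIntegral_ofReal_ne_top ht _⟩
    set q : ℝ≥0∞ := ENNReal.ofReal (t / (t + (n + 1 : ℕ))) with hq
    have hq1 : q < 1 := by
      rw [hq, ENNReal.ofReal_lt_one, div_lt_one (by positivity)]
      push_cast
      linarith [(Nat.cast_nonneg n : (0 : ℝ) ≤ n)]
    have hbound : ∀ (c : ℝ≥0∞) (g : Fin (n + 1) → ℝ → ℝ≥0∞),
        (∀ i x, g i x ≤ c * ENNReal.ofReal x) → ∀ u ∈ Set.Ioo (0 : ℝ) 1,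
        ∀ i x, rescale (1 - u) g i x ≤ c * ENNReal.ofReal (1 - u) * ENNReal.ofReal x := by
      intro c g hc u hu i x
      rw [mul_assoc, ← ENNReal.ofReal_mul (by linarith [hu.2])]
      exact hc i _
    -- Rescaling by $1-u$ turns the bound `c` into `c * (1 - u)`, so averaging over $u$ multiplies
    -- the error by `q`, while the terms of order `n` agree by induction. Two inequalities replace a
    -- difference, as both sides are extended nonnegative.
    have key : ∀ K : ℕ, ∀ (g : Fin (n + 1) → ℝ → ℝ≥0∞) (c : ℝ≥0∞), (∀ i, Measurable (g i)) →
        (∀ i j, i ≠ j → ∀ x, g i x * g j x = 0) → c ≠ ∞ →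
        (∀ i x, g i x ≤ c * ENNReal.ofReal x) →
        stickMoment t (n + 1) g ≤ pdIntegral t (n + 1) g + C * c ^ (n + 1) * q ^ K ∧
        pdIntegral t (n + 1) g ≤ stickMoment t (n + 1) g + C * c ^ (n + 1) * q ^ K := by
      intro K
      induction K with
      | zero =>
        intro g c hg hdisj hct hc
        rw [pow_zero, mul_one]
        constructor
        · refine (stickMoment_le ht hc).trans (le_add_left ?_)
          exact le_mul_of_one_le_left' le_self_add
        · refine (pdIntegral_le hct hc).trans (le_add_left ?_)
          rw [mul_comm]
          gcongr
          exact le_add_self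
      | succ K ihK =>
        intro g c hg hdisj hct hc
        have hrest : ∀ u ∈ Set.Ioo (0 : ℝ) 1, ∀ i : Fin (n + 1),
            stickMoment t n (rescale (1 - u) fun j => g (i.succAbove j)) =
            pdIntegral t n (rescale (1 - u) fun j => g (i.succAbove j)) := by
          intro u hu i
          refine ih _ (c * ENNReal.ofReal (1 - u)) (fun j => (hg _).comp (measurable_const_mul _))
            (fun j k hjk x => hdisj _ _ (fun h => hjk (Fin.succAbove_right_injective h)) _)
            (ENNReal.mul_ne_top hct ENNReal.ofReal_ne_top) fun j x => ?_
          exact hbound c g hc u hu (i.succAbove j) x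
        have hstep : ∀ u ∈ Set.Ioo (0 : ℝ) 1, _ := fun u hu =>
          ihK (rescale (1 - u) g) (c * ENNReal.ofReal (1 - u))
            (fun j => (hg j).comp (measurable_const_mul _))
            (fun j k hjk x => hdisj j k hjk _)
            (ENNReal.mul_ne_top hct ENNReal.ofReal_ne_top) (hbound c g hc u hu)
        have hint : ∫⁻ u, C * (c * ENNReal.ofReal (1 - u)) ^ (n + 1) * q ^ K ∂(betaMeasure 1 t) =
            C * c ^ (n + 1) * q ^ (K + 1) := by
          have h1 : ∀ u : ℝ, C * (c * ENNReal.ofReal (1 - u)) ^ (n + 1) * q ^ K =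
              C * c ^ (n + 1) * q ^ K * ENNReal.ofReal (1 - u) ^ (n + 1) := fun u => by
            rw [mul_pow]; ring
          simp only [h1]
          rw [lintegral_const_mul' _ _ (ENNReal.mul_ne_top (ENNReal.mul_ne_top hCt
            (ENNReal.pow_ne_top hct)) (ENNReal.pow_ne_top hq1.ne_top)),
            lintegral_one_sub_pow_betaMeasure ht, ← hq, pow_succ]
          ring
        have herr : Measurable fun u : ℝ =>
            C * (c * ENNReal.ofReal (1 - u)) ^ (n + 1) * q ^ K := by fun_prop
        rw [stickMoment_succ ht hg hdisj, pdIntegral_succ ht hg, ← hint,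
          ← lintegral_add_right _ herr, ← lintegral_add_right _ herr]
        constructor
        · refine lintegral_mono_ae ?_
          filter_upwards [ae_mem_Ioo_betaMeasure ht] with u hu
          simp only [hrest u hu]
          rw [add_right_comm]
          gcongr
          exact (hstep u hu).1
        · refine lintegral_mono_ae ?_
          filter_upwards [ae_mem_Ioo_betaMeasure ht] with u hu
          simp only [hrest u hu]
          rw [add_right_comm]
          gcongr
          exact (hstep u hu).2
    intro g c hg hdisj hct hc
    have hlim : ∀ a : ℝ≥0∞, Tendsto (fun K : ℕ => a + C * c ^ (n + 1) * q ^ K) atTop (𝓝 a) := by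
      intro a
      have h1 := ENNReal.Tendsto.const_mul (a := C * c ^ (n + 1))
        (ENNReal.tendsto_pow_atTop_nhds_zero_of_lt_one hq1)
        (Or.inr (ENNReal.mul_ne_top hCt (ENNReal.pow_ne_top hct)))
      simpa using h1.const_add a
    exact le_antisymm (ge_of_tendsto' (hlim _) fun K => (key K g c hg hdisj hct hc).1)
      (ge_of_tendsto' (hlim _) fun K => (key K g c hg hdisj hct hc).2)

end StickMoment

/-! ### Correlation functions of the Poisson–Dirichlet process -/

section PoissonDirichletProcess

variable {t : ℝ} {Ω : Type*} [MeasurableSpace Ω] {X : Ω → Set ℝ} {P : Measure Ω}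

lemma encard_range_inter {v : ℕ → ℝ} (hv : Function.Injective v) (A : Set ℝ) :
    (((Set.range v ∩ A).encard : ℕ∞) : ℝ≥0∞) = ∑' k, A.indicator 1 (v k) := by
  have h1 : Set.range v ∩ A = v '' (v ⁻¹' A) := by
    rw [Set.image_preimage_eq_inter_range, Set.inter_comm]
  rw [h1, hv.encard_image, ← ENNReal.tsum_set_one, tsum_subtype (v ⁻¹' A) fun _ => (1 : ℝ≥0∞)]
  rfl

/-- Almost surely no two sticks coincide, so counting points of the range is the same as summing
over indices. -/
lemma IsPoissonDirichletProcess.lintegral_prod_encard (ht : 0 < t)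
    (hX : IsPoissonDirichletProcess t X P) {n : ℕ} {A : Fin n → Set ℝ}
    (hA : ∀ i, MeasurableSet (A i)) :
    ∫⁻ ω, ∏ i, (((X ω ∩ A i).encard : ℕ∞) : ℝ≥0∞) ∂P =
      stickMoment t n fun i => (A i).indicator 1 := by
  have hm : Measurable fun c : Fin n → ℕ∞ => ∏ i, ((c i : ℕ∞) : ℝ≥0∞) :=
    Finset.measurable_fun_prod _ fun i _ => measurable_from_top.comp (measurable_pi_apply i)
  have h1 := ((hX.sameLaw n A hA).comp hm).lintegral_eq
  simp only [Function.comp_def] at h1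
  rw [h1]
  refine lintegral_congr_ae ?_
  filter_upwards [ae_injective_stickBreaking ht] with u hu
  exact Finset.prod_congr rfl fun i _ => encard_range_inter hu _

/-- Equality in law speaks only of counts; here the number of points outside the interval has mean
zero. -/
lemma IsPoissonDirichletProcess.ae_subset_Ioo (ht : 0 < t)
    (hX : IsPoissonDirichletProcess t X P) : ∀ᵐ ω ∂P, X ω ⊆ Set.Ioo 0 1 := by
  have hm : MeasurableSet (Set.Ioo (0 : ℝ) 1)ᶜ := measurableSet_Ioo.compl
  have h1 := hX.lintegral_prod_encard ht (A := fun _ : Fin 1 => (Set.Ioo (0 : ℝ) 1)ᶜ) fun _ => hm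
  have h2 : stickMoment t 1 (fun _ : Fin 1 => (Set.Ioo (0 : ℝ) 1)ᶜ.indicator 1) = 0 := by
    rw [stickMoment, lintegral_eq_zero_iff' (Measurable.aemeasurable (Finset.measurable_fun_prod _
      fun i _ => measurable_stickSum (measurable_one.indicator hm)))]
    filter_upwards [ae_iidBeta_mem_Ioo ht] with u hu
    simp only [Finset.univ_unique, Finset.prod_const, Finset.card_singleton, pow_one, stickSum,
      Pi.zero_apply, ENNReal.tsum_eq_zero]
    exact fun k => Set.indicator_of_notMem (Set.notMem_compl_iff.mpr (stickBreaking_mem_Ioo hu k)) _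
  rw [h2, lintegral_eq_zero_iff' (hX.isPointProcess.aemeasurable_prod_count fun _ => hm)] at h1
  filter_upwards [h1] with ω hω x hx
  by_contra hx'
  simp only [Finset.univ_unique, Finset.prod_const, Finset.card_singleton, pow_one,
    Pi.zero_apply, ENat.toENNReal_eq_zero, Set.encard_eq_zero] at hω
  exact Set.notMem_empty x (hω ▸ ⟨hx, hx'⟩)

lemma lintegral_indicator_mul_pdCorrelation {n : ℕ} {A : Fin n → Set ℝ}
    (hA : ∀ i, MeasurableSet (A i)) :
    pdIntegral t n (fun i => (A i).indicator 1) =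
      ∫⁻ x in Set.univ.pi A, ENNReal.ofReal (pdCorrelation t n x) := by
  rw [← lintegral_indicator (MeasurableSet.univ_pi hA), pdIntegral]
  refine lintegral_congr fun x => ?_
  by_cases hx : x ∈ Set.univ.pi A
  · rw [Set.indicator_of_mem hx, Finset.prod_eq_one, one_mul]
    exact fun i _ => Set.indicator_of_mem (hx i trivial) _
  · rw [Set.indicator_of_notMem hx]
    simp only [Set.mem_univ_pi, not_forall] at hx
    obtain ⟨i, hi⟩ := hx
    rw [Finset.prod_eq_zero (Finset.mem_univ i) (Set.indicator_of_notMem hi _), zero_mul]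

/-- Sets bounded away from 0 satisfy the linear domination needed in `stickMoment_eq_pdIntegral`;
hence the exhaustion by half-lines. -/
lemma indicator_le_natCast_mul_ofReal {m : ℕ} {A : Set ℝ}
    (hA : A ⊆ Set.Ioi (1 / ((m : ℝ) + 1))) (x : ℝ) :
    A.indicator 1 x ≤ ((m + 1 : ℕ) : ℝ≥0∞) * ENNReal.ofReal x := by
  by_cases hx : x ∈ A
  · have h1 : 1 / ((m : ℝ) + 1) < x := hA hx
    rw [Set.indicator_of_mem hx, Pi.one_apply, ← ENNReal.ofReal_natCast, ← ENNReal.ofReal_mul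
      (by positivity), ← ENNReal.ofReal_one]
    refine ENNReal.ofReal_le_ofReal ?_
    rw [div_lt_iff₀ (by positivity)] at h1
    push_cast
    linarith
  · rw [Set.indicator_of_notMem hx]
    exact zero_le

lemma setLIntegral_pdCorrelation_ne_top (ht : 0 < t) (n m : ℕ) :
    ∫⁻ x in Set.univ.pi fun _ : Fin n => Set.Ioi (1 / ((m : ℝ) + 1)),
      ENNReal.ofReal (pdCorrelation t n x) ≠ ∞ := by
  rw [← lintegral_indicator_mul_pdCorrelation fun _ => measurableSet_Ioi]
  refine ne_top_of_le_ne_top ?_ (pdIntegral_le (ENNReal.natCast_ne_top (m + 1)) fun i x =>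
    indicator_le_natCast_mul_ofReal subset_rfl x)
  exact ENNReal.mul_ne_top (ENNReal.pow_ne_top (ENNReal.natCast_ne_top _))
    (pdIntegral_ofReal_ne_top ht n)

lemma iUnion_Ioi_one_div : ⋃ m : ℕ, Set.Ioi (1 / ((m : ℝ) + 1)) = Set.Ioi 0 := by
  ext x
  simp only [Set.mem_iUnion, Set.mem_Ioi]
  exact ⟨fun ⟨m, hm⟩ => lt_trans (by positivity) hm, exists_nat_one_div_lt⟩

lemma monotone_Ioi_one_div : Monotone fun m : ℕ => Set.Ioi (1 / ((m : ℝ) + 1)) := fun m m' hm =>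
  Set.Ioi_subset_Ioi (one_div_le_one_div_of_le (by positivity) (by gcongr))

/-- The correlation functions of the Poisson–Dirichlet process. -/
theorem IsPoissonDirichletProcess.isCorrelationFunction (ht : 0 < t)
    (hX : IsPoissonDirichletProcess t X P) (n : ℕ) :
    IsCorrelationFunction X P n (pdCorrelation t n) := by
  refine IsCorrelationFunction.of_disjoint hX.isPointProcess measurable_pdCorrelation
    (pdCorrelation_nonneg ht) monotone_Ioi_one_div (fun _ => measurableSet_Ioi) ?_ ?_ ?_
  · rw [iUnion_Ioi_one_div]
    filter_upwards [hX.ae_subset_Ioo ht] with ω hω x hx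
    exact (hω hx).1
  · rw [iUnion_Ioi_one_div]
    intro x hx i
    rw [pdCorrelation] at hx
    exact (ite_ne_right_iff.mp hx).1.1 i
  · rintro A hA hdisj ⟨m, hm⟩
    rw [hX.lintegral_prod_encard ht hA, ← lintegral_indicator_mul_pdCorrelation hA]
    refine stickMoment_eq_pdIntegral ht n _ _ (fun i => measurable_one.indicator (hA i)) ?_
      (ENNReal.natCast_ne_top (m + 1)) fun i x => indicator_le_natCast_mul_ofReal (hm i) x
    intro i j hij x
    by_cases hx : x ∈ A i
    · rw [Set.indicator_of_notMem (Set.disjoint_left.mp (hdisj hij) hx), mul_zero]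
    · rw [Set.indicator_of_notMem hx, zero_mul]

end PoissonDirichletProcess

/-! ### The tail variable of the Poisson–Dirichlet process -/

section PoissonDirichletTailMap

variable {t : ℝ}

/-- The first correlation function of the Poisson–Dirichlet process. -/
noncomputable def pdDensity (t x : ℝ) : ℝ := pdCorrelation t 1 fun _ => x

@[fun_prop]
lemma measurable_pdDensity : Measurable (pdDensity t) :=
  measurable_pdCorrelation.comp (measurable_pi_lambda _ fun _ => measurable_id)

lemma pdDensity_nonneg (ht : 0 < t) (x : ℝ) : 0 ≤ pdDensity t x := pdCorrelation_nonneg ht _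

lemma pdDensity_of_mem {x : ℝ} (hx : x ∈ Set.Ioo (0 : ℝ) 1) :
    pdDensity t x = t * (1 - x) ^ (t - 1) / x := by
  simp [pdDensity, pdCorrelation, hx.1, hx.2]

lemma pdDensity_pos (ht : 0 < t) {x : ℝ} (hx : x ∈ Set.Ioo (0 : ℝ) 1) : 0 < pdDensity t x := by
  rw [pdDensity_of_mem hx]
  have h1 : 0 < 1 - x := sub_pos.mpr hx.2
  have h2 := hx.1
  positivity

lemma setLIntegral_fin_one (f : ℝ → ℝ≥0∞) (A : Set ℝ) :
    ∫⁻ x in Set.univ.pi fun _ : Fin 1 => A, f (x 0) = ∫⁻ x in A, f x := by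
  rw [← (volume_preserving_funUnique (Fin 1) ℝ).setLIntegral_comp_preimage_emb
    (MeasurableEquiv.measurableEmbedding _) f A]
  congr 2
  ext x
  simp [MeasurableEquiv.funUnique, Fin.forall_fin_one]

lemma integrableOn_pdDensity (ht : 0 < t) {ε : ℝ} (hε : 0 < ε) :
    IntegrableOn (pdDensity t) (Set.Ioi ε) := by
  obtain ⟨m, hm⟩ := exists_nat_one_div_lt hε
  have h1 := setLIntegral_pdCorrelation_ne_top ht 1 m
  have h2 : ∀ x : Fin 1 → ℝ, pdCorrelation t 1 x = pdDensity t (x 0) := fun x => by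
    rw [pdDensity]; congr 1; ext i; rw [Subsingleton.elim i 0]
  simp only [h2] at h1
  rw [setLIntegral_fin_one fun x => ENNReal.ofReal (pdDensity t x)] at h1
  refine IntegrableOn.mono_set ?_ (Set.Ioi_subset_Ioi hm.le)
  refine ⟨measurable_pdDensity.aestronglyMeasurable, ?_⟩
  rw [hasFiniteIntegral_iff_ofReal (Eventually.of_forall fun x => pdDensity_nonneg ht x)]
  exact h1.lt_top

lemma intervalIntegrable_pdDensity (ht : 0 < t) {a b : ℝ} (ha : 0 < a) (hb : 0 < b) :
    IntervalIntegrable (pdDensity t) volume a b := by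
  refine IntegrableOn.intervalIntegrable ((integrableOn_pdDensity ht
    (half_pos (lt_min ha hb))).mono_set fun x hx => ?_)
  exact (half_lt_self (lt_min ha hb)).trans_le hx.1

/-- Passing from exponent $t-1$ to $t$ avoids distinguishing $t<1$ from $t\ge1$. -/
lemma inv_le_pdDensity (ht : 0 < t) {x : ℝ} (hx : 0 < x) (hx' : x ≤ 1 / 2) :
    t * (1 / 2) ^ t * x⁻¹ ≤ pdDensity t x := by
  rw [pdDensity_of_mem ⟨hx, by linarith⟩, ← div_eq_mul_inv]
  gcongr
  calc ((1 : ℝ) / 2) ^ t ≤ (1 - x) ^ t := Real.rpow_le_rpow (by norm_num) (by linarith) ht.le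
    _ ≤ (1 - x) ^ (t - 1) :=
      Real.rpow_le_rpow_of_exponent_ge (by linarith) (by linarith) (by linarith)

lemma not_integrableOn_pdDensity (ht : 0 < t) {ε : ℝ} (hε : 0 < ε) :
    ¬ IntegrableOn (pdDensity t) (Set.Ioo 0 ε) := by
  intro h
  set δ := min ε (1 / 2) with hδ
  have hδ0 : 0 < δ := lt_min hε (by norm_num)
  have h1 : IntegrableOn (fun x => t * (1 / 2) ^ t * x⁻¹) (Set.Ioo 0 δ) := by
    refine Integrable.mono' (h.mono_set (Set.Ioo_subset_Ioo_right (min_le_left _ _)))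
      (by fun_prop) ?_
    filter_upwards [ae_restrict_mem measurableSet_Ioo] with x hx
    have h0 := hx.1
    rw [Real.norm_of_nonneg (by positivity)]
    exact inv_le_pdDensity ht h0 (hx.2.le.trans (min_le_right _ _))
  have hc : 0 < t * (1 / 2 : ℝ) ^ t := by positivity
  have h2 : IntegrableOn (fun x : ℝ => x⁻¹) (Set.Ioo 0 δ) := by
    have := h1.const_mul (t * (1 / 2 : ℝ) ^ t)⁻¹
    exact this.congr (Eventually.of_forall fun x => inv_mul_cancel_left₀ hc.ne' _)
  rw [← integrableOn_Ioc_iff_integrableOn_Ioo,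
    ← intervalIntegrable_iff_integrableOn_Ioc_of_le hδ0.le, intervalIntegrable_inv_iff] at h2
  rcases h2 with h2 | h2
  · exact hδ0.ne h2
  · exact h2 Set.left_mem_uIcc

lemma hasDerivAt_tailMap_pdDensity (ht : 0 < t) {x : ℝ} (hx : x ∈ Set.Ioo (0 : ℝ) 1) :
    HasDerivAt (tailMap (pdDensity t)) (-pdDensity t x) x := by
  refine intervalIntegral.integral_hasDerivAt_left (intervalIntegrable_pdDensity ht hx.1 one_pos)
    (measurable_pdDensity.stronglyMeasurable.stronglyMeasurableAtFilter) ?_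
  have h1 : ContinuousAt (fun x : ℝ => t * (1 - x) ^ (t - 1) / x) x := by
    refine ContinuousAt.div (continuousAt_const.mul (ContinuousAt.rpow_const ?_ ?_)) continuousAt_id
      hx.1.ne'
    · fun_prop
    · left; linarith [hx.2]
  refine h1.congr ?_
  filter_upwards [Ioo_mem_nhds hx.1 hx.2] with y hy
  exact (pdDensity_of_mem hy).symm

lemma continuousOn_tailMap_pdDensity (ht : 0 < t) :
    ContinuousOn (tailMap (pdDensity t)) (Set.Ioo 0 1) := fun _ hx =>
  (hasDerivAt_tailMap_pdDensity ht hx).continuousAt.continuousWithinAt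

lemma strictAntiOn_tailMap_pdDensity (ht : 0 < t) :
    StrictAntiOn (tailMap (pdDensity t)) (Set.Ioo 0 1) := by
  refine strictAntiOn_of_hasDerivWithinAt_neg (convex_Ioo 0 1)
    (f' := fun x => -pdDensity t x) (continuousOn_tailMap_pdDensity ht) ?_ ?_
  · intro x hx
    rw [interior_Ioo] at hx
    exact (hasDerivAt_tailMap_pdDensity ht hx).hasDerivWithinAt
  · intro x hx
    rw [interior_Ioo] at hx
    exact neg_neg_of_pos (pdDensity_pos ht hx)

/-- The lower bound $c/z$ on the density integrates to logarithmic growth near 0. -/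
lemma exists_le_tailMap_pdDensity (ht : 0 < t) {δ : ℝ} (hδ : 0 < δ) (y : ℝ) :
    ∃ x, 0 < x ∧ x ≤ δ ∧ y ≤ tailMap (pdDensity t) x := by
  set c := t * (1 / 2 : ℝ) ^ t with hc
  have hc0 : 0 < c := by positivity
  set y₀ := tailMap (pdDensity t) (1 / 2) with hy₀
  have hlow : ∀ x, 0 < x → x ≤ 1 / 2 →
      c * (Real.log (1 / 2) - Real.log x) + y₀ ≤ tailMap (pdDensity t) x := by
    intro x hx hx'
    have h1 := intervalIntegral.integral_add_adjacent_intervals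
      (intervalIntegrable_pdDensity ht hx (by norm_num : (0 : ℝ) < 1 / 2))
      (intervalIntegrable_pdDensity ht (by norm_num : (0 : ℝ) < 1 / 2) one_pos)
    have h2 : ∫ z in x..(1 / 2 : ℝ), c * z⁻¹ ≤ ∫ z in x..(1 / 2 : ℝ), pdDensity t z := by
      refine intervalIntegral.integral_mono_on hx' (IntervalIntegrable.const_mul
        (intervalIntegrable_inv_iff.mpr (Or.inr ?_)) _)
        (intervalIntegrable_pdDensity ht hx (by norm_num)) fun z hz => ?_
      · rw [Set.uIcc_of_le hx']
        exact fun h => absurd h.1 (not_le.mpr hx)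
      · exact inv_le_pdDensity ht (hx.trans_le hz.1) hz.2
    rw [intervalIntegral.integral_const_mul, integral_inv_of_pos hx (by norm_num),
      Real.log_div (by norm_num) hx.ne'] at h2
    rw [tailMap, ← h1]
    exact add_le_add_left h2 _
  have hlim := Real.tendsto_log_nhdsGT_zero.eventually
    (eventually_le_atBot (Real.log (1 / 2) - (y - y₀) / c))
  have hsmall : ∀ᶠ x : ℝ in 𝓝[>] 0, x ∈ Set.Ioo 0 (min δ (1 / 2)) :=
    Ioo_mem_nhdsGT (lt_min hδ (by norm_num))
  obtain ⟨x, h1, h2⟩ := (hlim.and hsmall).exists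
  refine ⟨x, h2.1, h2.2.le.trans (min_le_left _ _), le_trans ?_
    (hlow x h2.1 (h2.2.le.trans (min_le_right _ _)))⟩
  have h3 : (y - y₀) / c ≤ Real.log (1 / 2) - Real.log x := by linarith
  rw [div_le_iff₀ hc0] at h3
  linarith

lemma exists_tailMap_pdDensity_eq (ht : 0 < t) {δ y : ℝ} (hδ : δ ∈ Set.Ioo (0 : ℝ) 1)
    (hy : tailMap (pdDensity t) δ ≤ y) : ∃ x, 0 < x ∧ x ≤ δ ∧ tailMap (pdDensity t) x = y := by
  obtain ⟨x₁, h0, h1, h2⟩ := exists_le_tailMap_pdDensity ht hδ.1 y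
  have hcont : ContinuousOn (tailMap (pdDensity t)) (Set.Icc x₁ δ) :=
    (continuousOn_tailMap_pdDensity ht).mono fun z hz => ⟨h0.trans_le hz.1, hz.2.trans_lt hδ.2⟩
  obtain ⟨x, hx, hxy⟩ := intermediate_value_Icc' h1 hcont ⟨hy, h2⟩
  exact ⟨x, h0.trans_le hx.1, hx.2, hxy⟩

/-- A continuous injection on a Borel set is a measurable embedding. This replaces an explicit
inverse of the tail variable. -/
lemma exists_measurable_leftInverse {φ : ℝ → ℝ} {D : Set ℝ} (hD : MeasurableSet D)
    (hφ : ContinuousOn φ D) (hinj : Set.InjOn φ D) :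
    ∃ ψ : ℝ → ℝ, Measurable ψ ∧ ∀ x ∈ D, ψ (φ x) = x := by
  obtain ⟨ψ, hψ, h⟩ := (hφ.measurableEmbedding hD hinj).exists_measurable_extend
    (g := Subtype.val) measurable_subtype_coe fun _ => inferInstance
  exact ⟨ψ, hψ, fun x hx => congrFun h ⟨x, hx⟩⟩

end PoissonDirichletTailMap

/-! ### Limits near the origin -/

section Limits

variable {t : ℝ}

/-- Continuity at the origin. The function `h` is $(1-x)^{1-t}$ for the tail variable and 1 for the
logarithmic one. -/
lemma exists_forall_abs_sub_one_lt (t : ℝ) (n : ℕ) {h : ℝ → ℝ} (hh : ContinuousAt h 0) (h1 : h 0 = 1)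
    {ε : ℝ} (hε : 0 < ε) : ∃ δ ∈ Set.Ioo (0 : ℝ) 1, ∀ x : Fin n → ℝ, (∀ i, 0 < x i ∧ x i ≤ δ) →
      ∑ i, x i < 1 ∧ |(1 - ∑ i, x i) ^ (t - 1) * ∏ i, h (x i) - 1| < ε := by
  let F : (Fin n → ℝ) → ℝ := fun x => (1 - ∑ i, x i) ^ (t - 1) * ∏ i, h (x i)
  have hF0 : F 0 = 1 := by simp [F, h1]
  have hS : ContinuousAt (fun x : Fin n → ℝ => ∑ i, x i) 0 := by fun_prop
  have hF : ContinuousAt F 0 := by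
    refine ContinuousAt.mul (ContinuousAt.rpow_const (continuousAt_const.sub hS) (Or.inl (by simp))) ?_
    refine tendsto_finsetProd _ fun i _ => ?_
    exact ContinuousAt.comp (f := fun x : Fin n → ℝ => x i) (x := 0) (g := h) hh
      (continuous_apply i).continuousAt
  have hev1 : ∀ᶠ x in 𝓝 (0 : Fin n → ℝ), |F x - 1| < ε := by
    have := Metric.tendsto_nhds.mp hF ε hε
    simpa only [hF0, Real.dist_eq] using this
  have hev2 : ∀ᶠ x in 𝓝 (0 : Fin n → ℝ), ∑ i, x i < 1 :=
    hS.eventually_lt continuousAt_const (by simp)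
  obtain ⟨η, hη, hball⟩ := Metric.eventually_nhds_iff.mp (hev1.and hev2)
  refine ⟨min (η / 2) (1 / 2), ⟨lt_min (half_pos hη) (by norm_num),
    (min_le_right _ _).trans_lt (by norm_num)⟩, fun x hx => ?_⟩
  have hdist : dist x 0 < η := by
    refine (dist_pi_lt_iff hη).mpr fun i => ?_
    rw [Pi.zero_apply, Real.dist_eq, sub_zero, abs_of_pos (hx i).1]
    linarith [(hx i).2, min_le_left (η / 2) (1 / 2)]
  exact ⟨(hball hdist).2, (hball hdist).1⟩

/-- The Jacobian cancels $t^n/\prod x_i$; `h` records how the variable differs from $-t\log x$. -/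
lemma pdCorrelation_mul_prod_inv (ht : 0 < t) {n : ℕ} {x w h : Fin n → ℝ} (hx : ∀ i, 0 < x i)
    (hS : ∑ i, x i < 1) (hw : ∀ i, |w i|⁻¹ = x i * h i / t) :
    pdCorrelation t n x * ∏ i, |w i|⁻¹ = (1 - ∑ i, x i) ^ (t - 1) * ∏ i, h i := by
  have hP : (∏ i, x i) ≠ 0 := (Finset.prod_pos fun i _ => hx i).ne'
  rw [pdCorrelation, if_pos ⟨hx, hS⟩]
  simp only [hw]
  rw [Finset.prod_div_distrib, Finset.prod_mul_distrib, Finset.prod_const, Finset.card_univ,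
    Fintype.card_fin]
  field_simp

end Limits

/-! ### Convergence to the Poisson process -/

section TailProcess

variable {t : ℝ} {Ω : Type*} [MeasurableSpace Ω] {X : Ω → Set ℝ} {P : Measure Ω}

/-- Correlation functions of the image of a Poisson–Dirichlet process under a change of variable
are unique up to null sets. -/
lemma IsPoissonDirichletProcess.ae_eq_of_image (ht : 0 < t)
    (hX : IsPoissonDirichletProcess t X P) {φ ψ : ℝ → ℝ} (hφ : ContinuousOn φ (Set.Ioo 0 1))
    (hinj : Set.InjOn φ (Set.Ioo 0 1)) (hψ : Measurable ψ)
    (hψφ : ∀ x ∈ Set.Ioo (0 : ℝ) 1, ψ (φ x) = x) {n : ℕ} {ρ ρ' : (Fin n → ℝ) → ℝ}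
    (h : IsCorrelationFunction (fun ω => φ '' X ω) P n ρ)
    (h' : IsCorrelationFunction (fun ω => φ '' X ω) P n ρ') : ρ =ᵐ[volume] ρ' := by
  set E := φ '' Set.Ioo 0 1 with hE
  have hEm : MeasurableSet E := measurableSet_Ioo.image_of_continuousOn_injOn hφ hinj
  -- The complement of the image carries no points, so including it makes the sets exhaust $\mathbb
  -- R$. On the image they pull back to half-lines away from 0, where factorial moments are finite.
  let B : ℕ → Set ℝ := fun m => Eᶜ ∪ ψ ⁻¹' Set.Ioi (1 / ((m : ℝ) + 1))
  have hBm : ∀ m, MeasurableSet (B m) := fun m => hEm.compl.union (hψ measurableSet_Ioi)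
  refine h.ae_eq h' (B := B) ?_ hBm ?_ fun m => ?_
  · exact fun m m' hm => Set.union_subset_union_right _
      (Set.preimage_mono (monotone_Ioi_one_div hm))
  · rw [← Set.union_iUnion, ← Set.preimage_iUnion, iUnion_Ioi_one_div]
    refine Set.eq_univ_of_forall fun y => ?_
    by_cases hy : y ∈ E
    · obtain ⟨x, hx, rfl⟩ := hy
      right
      rw [Set.mem_preimage, hψφ x hx]
      exact hx.1
    · exact Or.inl hy
  · rw [← h.lintegral_count _ fun _ => hBm m]
    refine ne_top_of_le_ne_top (setLIntegral_pdCorrelation_ne_top ht n m) ?_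
    rw [← (hX.isCorrelationFunction ht n).lintegral_count _ fun _ => measurableSet_Ioi]
    refine lintegral_mono_ae ?_
    filter_upwards [hX.ae_subset_Ioo ht] with ω hω
    have hsub : {x : Fin n → ℝ | Function.Injective x ∧ ∀ i, x i ∈ φ '' X ω ∩ B m} ⊆
        (fun y i => φ (y i)) '' {x : Fin n → ℝ | Function.Injective x ∧
          ∀ i, x i ∈ X ω ∩ Set.Ioi (1 / ((m : ℝ) + 1))} := by
      rintro x ⟨hxi, hx⟩
      choose y hy using fun i => (hx i).1
      have hyx : (fun i => φ (y i)) = x := funext fun i => (hy i).2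
      refine ⟨y, ⟨fun i j hij => hxi ?_, fun i => ⟨(hy i).1, ?_⟩⟩, hyx⟩
      · rw [← (hy i).2, ← (hy j).2, hij]
      · have hB := (hx i).2
        rw [← (hy i).2] at hB
        rcases hB with hB | hB
        · exact absurd ⟨y i, hω (hy i).1, rfl⟩ hB
        · rwa [Set.mem_preimage, hψφ _ (hω (hy i).1)] at hB
    exact_mod_cast (Set.encard_le_encard hsub).trans (Set.encard_image_le _ _)

lemma IsPoissonDirichletProcess.isCorrelationFunction_pdDensity (ht : 0 < t)
    (hX : IsPoissonDirichletProcess t X P) :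
    IsCorrelationFunction X P 1 fun x => pdDensity t (x 0) := by
  convert hX.isCorrelationFunction ht 1 using 1
  funext x
  rw [pdDensity]
  congr 1
  ext i
  rw [Subsingleton.elim i 0]

lemma IsPoissonDirichletProcess.ae_eq_pdDensity (ht : 0 < t)
    (hX : IsPoissonDirichletProcess t X P) {ρ₁ : ℝ → ℝ}
    (h : IsCorrelationFunction X P 1 fun x => ρ₁ (x 0)) : ρ₁ =ᵐ[volume] pdDensity t := by
  have h1 := hX.ae_eq_of_image ht (φ := id) (ψ := id) continuousOn_id (Set.injOn_id _)
    measurable_id (fun _ _ => rfl) (n := 1)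
    (h.congr_set (Eventually.of_forall fun ω => (Set.image_id _).symm))
    ((hX.isCorrelationFunction_pdDensity ht).congr_set
      (Eventually.of_forall fun ω => (Set.image_id _).symm))
  have h2 := ((volume_preserving_funUnique (Fin 1) ℝ).symm _).quasiMeasurePreserving.ae h1
  filter_upwards [h2] with x hx
  exact hx

/-- The correlation functions of the process that converges to the tail process. -/
noncomputable def pdTailCorrelation (t : ℝ) (ψ : ℝ → ℝ) (n : ℕ) (τ : ℝ) : (Fin n → ℝ) → ℝ :=
  (Set.univ.pi fun _ => (fun x => tailMap (pdDensity t) x - τ) '' Set.Ioo 0 1).indicator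
    fun ξ => pdCorrelation t n (fun i => ψ (ξ i + τ)) * ∏ i, |-pdDensity t (ψ (ξ i + τ))|⁻¹

lemma IsPoissonDirichletProcess.isCorrelationFunction_tail (ht : 0 < t)
    (hX : IsPoissonDirichletProcess t X P) {ψ : ℝ → ℝ} (hψ : Measurable ψ)
    (hψφ : ∀ x ∈ Set.Ioo (0 : ℝ) 1, ψ (tailMap (pdDensity t) x) = x) (n : ℕ) (τ : ℝ) :
    IsCorrelationFunction (fun ω => (fun x => tailMap (pdDensity t) x - τ) '' X ω) P n
      (pdTailCorrelation t ψ n τ) := by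
  refine (hX.isCorrelationFunction ht n).image measurableSet_Ioo
    (φ := fun x => tailMap (pdDensity t) x - τ) (φ' := fun x => -pdDensity t x)
    (ψ := fun y => ψ (y + τ)) ?_ (by fun_prop) ?_ ?_ (by fun_prop) ?_ (hX.ae_subset_Ioo ht)
  · exact fun x hx => ((hasDerivAt_tailMap_pdDensity ht hx).sub_const τ).hasDerivWithinAt
  · exact fun x hx => (neg_neg_of_pos (pdDensity_pos ht hx)).ne
  · exact fun x hx y hy hxy =>
      (strictAntiOn_tailMap_pdDensity ht).injOn hx hy (sub_left_injective hxy)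
  · intro x hx
    simp only [sub_add_cancel]
    exact hψφ x hx

lemma tendstoUniformlyOn_pdTailCorrelation (ht : 0 < t) {ψ : ℝ → ℝ}
    (hψφ : ∀ x ∈ Set.Ioo (0 : ℝ) 1, ψ (tailMap (pdDensity t) x) = x) (n : ℕ)
    {K : Set (Fin n → ℝ)} (hK : IsCompact K) :
    TendstoUniformlyOn (pdTailCorrelation t ψ n) (fun _ => 1) atTop K := by
  rw [Metric.tendstoUniformlyOn_iff]
  intro ε hε
  have hh : ContinuousAt (fun x : ℝ => ((1 - x) ^ (t - 1))⁻¹) 0 := by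
    refine ContinuousAt.inv₀ (ContinuousAt.rpow_const (by fun_prop) (Or.inl (by norm_num))) ?_
    simp
  obtain ⟨δ, hδ, hF⟩ := exists_forall_abs_sub_one_lt t n hh (by simp) hε
  obtain ⟨R, hR⟩ := hK.isBounded.exists_norm_le
  -- With $|\xi_i|\le R$ on `K`, this threshold puts every preimage $x_i$ in $(0,\delta]$.
  filter_upwards [eventually_ge_atTop (tailMap (pdDensity t) δ + R)] with τ hτ ξ hξ
  have hξR : ∀ i, tailMap (pdDensity t) δ ≤ ξ i + τ := by
    intro i
    have h1 := (norm_le_pi_norm ξ i).trans (hR ξ hξ)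
    rw [Real.norm_eq_abs] at h1
    linarith [neg_abs_le (ξ i)]
  choose x hx0 hxδ hx using fun i => exists_tailMap_pdDensity_eq ht hδ (hξR i)
  have hxm : ∀ i, x i ∈ Set.Ioo (0 : ℝ) 1 := fun i => ⟨hx0 i, (hxδ i).trans_lt hδ.2⟩
  have hψx : ∀ i, ψ (ξ i + τ) = x i := fun i => by rw [← hx i, hψφ _ (hxm i)]
  obtain ⟨hS, habs⟩ := hF x fun i => ⟨hx0 i, hxδ i⟩
  rw [pdTailCorrelation, Set.indicator_of_mem]
  · simp only [hψx]
    rw [dist_comm, Real.dist_eq, pdCorrelation_mul_prod_inv ht hx0 hS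
      (h := fun i => ((1 - x i) ^ (t - 1))⁻¹)]
    · exact habs
    · intro i
      rw [abs_neg, abs_of_pos (pdDensity_pos ht (hxm i)), pdDensity_of_mem (hxm i), inv_div]
      field_simp
  · exact fun i _ => ⟨x i, hxm i, by simp [hx i]⟩

lemma IsPoissonDirichletProcess.ae_image_eq (ht : 0 < t) (hX : IsPoissonDirichletProcess t X P)
    {φ φ' : ℝ → ℝ} (h : Set.EqOn φ φ' (Set.Ioo 0 1)) :
    ∀ᵐ ω ∂P, φ '' (X ω ∩ Set.Ioc 0 1) = φ' '' X ω := by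
  filter_upwards [hX.ae_subset_Ioo ht] with ω hω
  rw [Set.inter_eq_left.mpr (hω.trans Set.Ioo_subset_Ioc_self)]
  exact Set.image_congr fun x hx => h (hω hx)

variable {Ω' : Type*} [MeasurableSpace Ω'] {P' : Measure Ω'} {Y : Ω' → Set ℝ}

lemma IsPoissonDirichletProcess.isTailProcess [IsProbabilityMeasure P'] (ht : 0 < t)
    (hX : IsPoissonDirichletProcess t X P) (hY : IsPoissonProcess Y P' volume) :
    IsTailProcess X P Y P' := by
  obtain ⟨ψ, hψ, hψφ⟩ := exists_measurable_leftInverse measurableSet_Ioo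
    (continuousOn_tailMap_pdDensity ht) (strictAntiOn_tailMap_pdDensity ht).injOn
  refine ⟨hX.isPointProcess, ?_, hY.isPointProcess, pdDensity t,
    hX.isCorrelationFunction_pdDensity ht, fun ε hε => integrableOn_pdDensity ht hε,
    fun ε hε => not_integrableOn_pdDensity ht hε, fun n => ⟨pdTailCorrelation t ψ n, fun _ => 1,
    fun τ _ => ?_, hY.isCorrelationFunction_one n,
    fun K hK => tendstoUniformlyOn_pdTailCorrelation ht hψφ n hK⟩⟩
  · filter_upwards [hX.ae_subset_Ioo ht] with ω hω x hx
    exact (hω hx).1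
  · refine (hX.isCorrelationFunction_tail ht hψ hψφ n τ).congr_set ?_
    filter_upwards [hX.ae_image_eq ht (Set.eqOn_refl (fun x => tailMap (pdDensity t) x - τ) _)]
      with ω hω
    exact hω.symm

/-- The versions in the hypothesis agree almost everywhere with the explicit ones, so their
pointwise limits do too, and `s` is 1 almost everywhere. -/
lemma IsPoissonDirichletProcess.isPoissonProcess_of_isTailProcess [IsProbabilityMeasure P']
    (ht : 0 < t) (hX : IsPoissonDirichletProcess t X P) (h : IsTailProcess X P Y P') :
    IsPoissonProcess Y P' volume := by
  obtain ⟨ψ, hψ, hψφ⟩ := exists_measurable_leftInverse measurableSet_Ioo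
    (continuousOn_tailMap_pdDensity ht) (strictAntiOn_tailMap_pdDensity ht).injOn
  obtain ⟨ρ₁, hρ₁, -, -, hlim⟩ := h.exists_density
  have hae := hX.ae_eq_pdDensity ht hρ₁
  have htail : tailMap ρ₁ = tailMap (pdDensity t) := by
    funext x
    refine intervalIntegral.integral_congr_ae ?_
    filter_upwards [hae] with y hy _
    exact hy
  refine isPoissonProcess_of_isCorrelationFunction_one h.isPointProcess_limit fun n => ?_
  obtain ⟨r, s, hr, hs, hrs⟩ := hlim n
  refine hs.congr_ae measurable_const (fun _ => zero_le_one) ?_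
  -- Only integer shifts are used, so that the exceptional null sets are countably many.
  have hrk : ∀ k : ℕ, r k =ᵐ[volume] pdTailCorrelation t ψ n k := by
    intro k
    have h1 := (hr k (Nat.cast_nonneg k)).congr_set (hX.ae_image_eq ht
      (Set.eqOn_refl (fun x => tailMap ρ₁ x - k) _))
    rw [htail] at h1
    refine hX.ae_eq_of_image ht ?_ ?_ (ψ := fun y => ψ (y + k)) (by fun_prop) ?_ h1
      (hX.isCorrelationFunction_tail ht hψ hψφ n k)
    · exact (continuousOn_tailMap_pdDensity ht).sub continuousOn_const
    · exact fun x hx y hy hxy =>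
        (strictAntiOn_tailMap_pdDensity ht).injOn hx hy (sub_left_injective hxy)
    · intro x hx
      simp only [sub_add_cancel]
      exact hψφ x hx
  filter_upwards [ae_all_iff.mpr hrk] with ξ hξ
  have h1 := ((hrs {ξ} isCompact_singleton).tendsto_at (Set.mem_singleton ξ)).comp
    tendsto_natCast_atTop_atTop
  have h2 := ((tendstoUniformlyOn_pdTailCorrelation ht hψφ n
    isCompact_singleton).tendsto_at (Set.mem_singleton ξ)).comp tendsto_natCast_atTop_atTop
  refine tendsto_nhds_unique h1 (h2.congr fun k => (hξ k).symm)

lemma IsPoissonDirichletProcess.exists_isCorrelationFunction_log (ht : 0 < t)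
    (hX : IsPoissonDirichletProcess t X P) (n : ℕ) : ∃ r : (Fin n → ℝ) → ℝ,
      IsCorrelationFunction (fun ω => (fun x => -(t * Real.log x)) '' X ω) P n r ∧
      ∀ ε : ℝ, 0 < ε → ∃ M : ℝ, ∀ ξ : Fin n → ℝ, (∀ i, M ≤ ξ i) → |r ξ - 1| < ε := by
  have hψφ : ∀ x ∈ Set.Ioo (0 : ℝ) 1, Real.exp (-(-(t * Real.log x)) / t) = x := by
    intro x hx
    rw [neg_neg, mul_div_cancel_left₀ _ ht.ne', Real.exp_log hx.1]
  refine ⟨_, (hX.isCorrelationFunction ht n).image measurableSet_Ioo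
    (φ := fun x => -(t * Real.log x)) (φ' := fun x => -(t * x⁻¹))
    (ψ := fun y => Real.exp (-y / t)) ?_ (by fun_prop) ?_ ?_ (by fun_prop) hψφ
    (hX.ae_subset_Ioo ht), ?_⟩
  · exact fun x hx => ((Real.hasDerivAt_log hx.1.ne').const_mul t).neg.hasDerivWithinAt
  · exact fun x hx => neg_ne_zero.mpr (mul_ne_zero ht.ne' (inv_ne_zero hx.1.ne'))
  · intro x hx y hy hxy
    rw [← hψφ x hx, ← hψφ y hy]
    simp only at hxy
    rw [hxy]
  · intro ε hε
    obtain ⟨δ, hδ, hF⟩ := exists_forall_abs_sub_one_lt t n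
      (continuousAt_const : ContinuousAt (fun _ : ℝ => (1 : ℝ)) 0) rfl hε
    -- The image of `δ`: $\xi_i\ge-t\log\delta$ means $x_i\le\delta$.
    refine ⟨-(t * Real.log δ), fun ξ hξ => ?_⟩
    set x : Fin n → ℝ := fun i => Real.exp (-ξ i / t) with hx
    have hx0 : ∀ i, 0 < x i := fun i => Real.exp_pos _
    have hxδ : ∀ i, x i ≤ δ := by
      intro i
      rw [hx, ← Real.le_log_iff_exp_le hδ.1, div_le_iff₀ ht]
      linarith [hξ i]
    obtain ⟨hS, habs⟩ := hF x fun i => ⟨hx0 i, hxδ i⟩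
    rw [Set.indicator_of_mem]
    · rw [pdCorrelation_mul_prod_inv ht hx0 hS (h := fun _ => 1)]
      · exact habs
      · intro i
        have := hx0 i
        rw [abs_neg, abs_of_pos (by positivity), mul_inv, inv_inv, mul_one]
        exact inv_mul_eq_div _ _
    · refine fun i _ => ⟨x i, ⟨hx0 i, (hxδ i).trans_lt hδ.2⟩, ?_⟩
      simp only [hx, Real.log_exp]
      field_simp

end TailProcess
theorem proposition3p1 (t : ℝ) (ht : 0 < t)
    {Ω : Type*} [MeasurableSpace Ω] (P : Measure Ω) [IsProbabilityMeasure P]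
    (X : Ω → Set ℝ) (hX : IsPoissonDirichletProcess t X P) :
    -- the tail process of `X` is the Poisson process on `ℝ` with constant density 1
    (∀ {Ω' : Type*} [MeasurableSpace Ω'] (P' : Measure Ω') [IsProbabilityMeasure P']
      (Y : Ω' → Set ℝ), IsTailProcess X P Y P' ↔ IsPoissonProcess Y P' volume) ∧
    -- in the logarithmic variable `ξ = - t log x` the correlation functions tend to those of the
    -- Poisson process as `min ξᵢ → +∞`
    (∀ n : ℕ, ∃ r : (Fin n → ℝ) → ℝ,
      IsCorrelationFunction (fun ω => (fun x => -(t * Real.log x)) '' X ω) P n r ∧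
      ∀ ε : ℝ, 0 < ε → ∃ M : ℝ, ∀ ξ : Fin n → ℝ, (∀ i, M ≤ ξ i) → |r ξ - 1| < ε) := by
  refine ⟨fun P' _ Y => ⟨fun h => hX.isPoissonProcess_of_isTailProcess ht h,
    fun h => hX.isTailProcess ht h⟩, fun n => hX.exists_isCorrelationFunction_log ht n⟩
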